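/- **Setting.** Let $K$ be an ordered field and let $(\mathcal F,\partial,\int)$ be an ordinary shifted integro-differential algebra over $K$: a commutative unital $K$-algebra with a $K$-derivation $\partial$ and a $K$-linear map $\int$ such that $\partial\int=1$, $f\int g=\int fg+\int f'\!\int g$ and $\ker\partial=K$, together with a group homomorphism $c\mapsto S_c$ from $(K,+)$ to $\mathrm{Aut}_K(\mathcal F)$ with $[S_c,\partial]=0$ and $[S_c,\int]=\mathtt e_c\int$, where $\mathtt e:=1-\int\partial$ and $\mathtt e_c:=\mathtt e\circ S_c:\mathcal F\to K$. Write $f(c):=\mathtt e_c(f)$ and $\int_a:=(1-\mathtt e_a)\int$. Let $H:K\to K$, $H(a)=1$ for $a>0$ and $H(a)=0$ for $a\le 0$, and $\bar H=1-H$. *Operators.* $\mathcal F_\Phi[\partial,\int]$ is the $K$-algebra generated by the algebra $\mathcal F$, by $\partial$, $\int$ and $\mathtt e_a$ $(a\in K)$, subject to $\mathtt e_a\mathtt e_b=\mathtt e_b$, $\mathtt e_af=f(a)\mathtt e_a$, $\partial f=f\partial+f'$, $\partial\mathtt e_a=0$, $\partial\int=1$, $\int f\int=(\int f)\int-\int(\int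 f)$, $\int f\partial=f-\int f'-f(0)\mathtt e_0$, $\int f\mathtt e_a=(\int f)\mathtt e_a$. It acts on $\mathcal F$, and each of its elements is a unique $K$-linear combination of terms $u\partial^i$, $u\int v$, $u\,\mathtt e_a\partial^i$, $u\,\mathtt e_a\int v$ (with $a\ne0$ in the last type), $K$-bilinear in $u,v\in\mathcal F$. *Distributions.* $\mathcal{PF}$ is the $\mathcal F$-algebra with $\mathcal F$-basis $1,H_a$ $(a\in K)$ and $H_aH_b=H_{\max(a,b)}$. $\mathcal{DF}$ is the free $\mathcal F$-module on $1,H_a^{(k)}$ $(a\in K,k\ge 0)$ with derivation extending that of $\mathcal F$ and $H_a^{(k)}\mapsto H_a^{(k+1)}$, modulo the differential submodule generated by $f\delta_a-f(a)\delta_a$, where $\delta_a^{(k)}:=H_a^{(k+1)}$. On it, $\int$ and the evaluations $\mathtt e_c$ are given by those of $\mathcal F$ and $\int fH_a=(\int_af)H_a+\bar H(a)(\int f)(a)$, $\int f\delta_a=f(a)(H_a-\bar H(a))$, $\int f\delta_a^{(k+1)}=f\delta_a^{(k)}-\int f'\delta_a^{(k)}$; $\mathtt e_c(fH_a)=f(c)\bar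 H(a-c)$, $\mathtt e_c(f\delta_a^{(k)})=0$. With univariate copies in the variables $x$ and $\xi$ (tensor products over $K$), the bivariate distribution module $D_2(\mathcal F)$ is generated by $(\mathcal D_x\otimes\mathcal P_\xi)+(\mathcal P_x\otimes\mathcal D_\xi)$ (amalgamated along $\mathcal P_x\otimes\mathcal P_\xi$) and by the symbols $H^{(n)}(x-\xi)$ with coefficients in $\mathcal P_x\otimes\mathcal P_\xi$, subject to $(H_a(x)-H_a(\xi))H(x-\xi)=H_a(x)\bar H_a(\xi)$ and $(H_a(x)-H_a(\xi))H^{(n)}(x-\xi)=0$ for $n\ge1$, where $\bar H_a=1-H_a$. Put $\delta^{(i)}(x-\xi):=H^{(i+1)}(x-\xi)$ and $\delta^{(i)}(\xi-a):=\delta^{(i)}_a(\xi)$. The operators $\int^\xi$ and $\mathtt e^\xi_c$ on $D_2(\mathcal F)$ are those of the $\xi$-factors on the first part (the $x$-factors being constants), and, for $p\in\mathcal P_x$, $f\in\mathcal F$, $$\textstyle\int^\xi p(x)f(\xi)H(x-\xi)=p(x)\big(\int^\xi f-\int^xf\big)H(x-\xi)+p(x)\big(\int^xf\big)H_0(x),$$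 $$\textstyle\int^\xi p(x)f(\xi)H^{(n+1)}(x-\xi)=\int^\xi p(x)f'(\xi)H^{(n)}(x-\xi)-p(x)f(\xi)H^{(n)}(x-\xi),$$ $\mathtt e_c^\xi\,p(x)q(\xi)H(x-\xi)=\mathtt e_c(q)\,p(x)H_c(x)$, and $\mathtt e_c^\xi\,p(x)q(\xi)H^{(n)}(x-\xi)=0$ for $n\ge1$. Put $\int_c^\xi:=(1-\mathtt e_c^\xi)\int^\xi$ and $\int_\alpha^\beta:=\int_\alpha^\xi-\int_\beta^\xi$. *Extraction.* $\eta:\mathcal F_\Phi[\partial,\int]\to D_2(\mathcal F)$, $G\mapsto G_{x\xi}$, is the $K$-linear map with $u\partial^i\mapsto u(x)\,\delta^{(i)}(x-\xi)$, $\;u\int v\mapsto u(x)v(\xi)\,(H(x-\xi)+H_0(\xi)-1)$, $\;u\,\mathtt e_a\partial^i\mapsto(-1)^iu(x)\,\delta^{(i)}(\xi-a)$, $\;u\,\mathtt e_a\int v\mapsto u(x)v(\xi)\,(H_0(\xi)-H_a(\xi))$. *Intervals.* For $p,q\in\mathcal{PF}$ and $\alpha<\beta$, "$p=q$ on $[\alpha,\beta]$"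 means that $p-q$ lies in the ideal generated by $\bar H_\alpha$ and $H_\beta$. *Boundary problems.* A Stieltjes boundary problem $(T,\mathcal B)$ consists of a monic $T=\partial^n+\sum_{i<n}t_i\partial^i$ with $t_i\in\mathcal F$ and of a space $\mathcal B\subset\mathcal F^*$ spanned by $n$ linearly independent Stieltjes conditions (functionals induced by elements of the right ideal of $\mathcal F_\Phi[\partial,\int]$ generated by the $\mathtt e_a$). It is regular if $\ker T\oplus\mathcal B^\perp=\mathcal F$. Its Green's operator is $G\in\mathcal F_\Phi[\partial,\int]$ with $TG=1$ (as operators on $\mathcal F$) and $\mathrm{Im}\,G=\mathcal B^\perp$. We call $g\in D_2(\mathcal F)$ its Green's function on $[\alpha,\beta]$ if for each $f\in\mathcal F$ there is exactly one $u\in\mathcal F$ with $Tu=f$ and $b(u)=0$ for all $b\in\mathcal B$, and $u(x)=\int_\alpha^\beta g(x,\xi)f(\xi)$ on $[\alpha,\beta]$. **Theorem.** Let $G\in\mathcal F_\Phi[\partial,\int]$ with extraction $g(x,\xi):=G_{x\xi}\in D_2(\mathcal F)$. Let $\alpha<\beta$ in $K$ with $\alpha\le0\le\beta$, such that $\alpha\le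 a\le\beta$ for every $a$ for which a term $u\,\mathtt e_a\partial^i$ or $u\,\mathtt e_a\int v$ occurs in the normal form of $G$, and such that $\alpha<a$ if a term $u\,\mathtt e_a\partial^i$ occurs. Then for all $f\in\mathcal F$ the integral $\int_\alpha^\beta g(x,\xi)f(\xi)$ lies in the copy of $\mathcal{PF}$ in the variable $x$, and $$Gf(x)=\int_\alpha^\beta g(x,\xi)\,f(\xi)\qquad\text{on }[\alpha,\beta].$$ If $G$ is the Green's operator of a regular Stieltjes boundary problem, then $g(x,\xi)$ is its Green's function on $[\alpha,\beta]$. -/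

import Mathlib

set_option linter.unusedSectionVars false

open scoped TensorProduct

noncomputable section

namespace IntDiffDirac

section

universe u v

variable (K : Type u) (F : Type v)

/-! ## Ordinary shifted integro-differential algebras -/

/-- An ordinary integro-differential algebra over the field `K`: a commutative unital `K`-algebra
with a `K`-derivation `der` and a `K`-linear operator `int` that satisfy the section axiom, the
strong Rota-Baxter axiom `f ∫ g = ∫ f g + ∫ f' ∫ g`, and `ker der = K`. -/
class OrdinaryIDAlgebra [Field K] [CommRing F] [Algebra K F] where
  der : Derivation K F F
  int : F →ₗ[K] F
  der_int : ∀ f : F, der (int f) = f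
  strong_rotaBaxter : ∀ f g : F, f * int g = int (f * g) + int (der f * int g)
  algebraMap_injective : Function.Injective (algebraMap K F)
  ker_der : ∀ f : F, der f = 0 ↔ ∃ c : K, algebraMap K F c = f

variable {F}

section Evaluation

variable [Field K] [CommRing F] [Algebra K F] [OrdinaryIDAlgebra K F]

/-- The derivation `∂` as a linear map. -/
def dd : F →ₗ[K] F := (OrdinaryIDAlgebra.der : Derivation K F F).toLinearMap

/-- The Rota-Baxter operator `∫`. -/
def ii : F →ₗ[K] F := OrdinaryIDAlgebra.int

theorem dd_mul (f g : F) : dd K (f * g) = f * dd K g + dd K f * g := by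
  have := (OrdinaryIDAlgebra.der : Derivation K F F).leibniz f g
  simp only [smul_eq_mul] at this
  change OrdinaryIDAlgebra.der (K := K) (f * g) = _
  rw [this, mul_comm g]; rfl

theorem dd_ii (f : F) : dd K (ii K f) = f := OrdinaryIDAlgebra.der_int f

theorem dd_algebraMap (c : K) : dd K (algebraMap K F c) = 0 :=
  (OrdinaryIDAlgebra.ker_der (K := K) _).2 ⟨c, rfl⟩

theorem exists_evl (f : F) : ∃ c : K, algebraMap K F c = f - ii K (dd K f) :=
  (OrdinaryIDAlgebra.ker_der (K := K) _).1 (by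
    change dd K (f - ii K (dd K f)) = 0
    rw [map_sub, dd_ii, sub_self])

/-- The underlying function of the induced evaluation. -/
def evlFun (f : F) : K := Classical.choose (exists_evl K f)

theorem evlFun_spec (f : F) : algebraMap K F (evlFun K f) = f - ii K (dd K f) :=
  Classical.choose_spec (exists_evl K f)

/-- The induced evaluation `e = 1 - ∫ ∂`, which is a character `F → K`. -/
def evl : F →ₐ[K] K :=
  AlgHom.ofLinearMap
    { toFun := evlFun K
      map_add' := fun f g => OrdinaryIDAlgebra.algebraMap_injective (K := K) (F := F) (by
        rw [map_add, evlFun_spec, evlFun_spec, evlFun_spec, map_add, map_add]; ring)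
      map_smul' := fun c f => OrdinaryIDAlgebra.algebraMap_injective (K := K) (F := F) (by
        rw [RingHom.id_apply, smul_eq_mul, map_mul, evlFun_spec, evlFun_spec, map_smul, map_smul,
          ← Algebra.smul_def, smul_sub]) }
    (OrdinaryIDAlgebra.algebraMap_injective (K := K) (F := F) (by
      change algebraMap K F (evlFun K 1) = _
      rw [evlFun_spec, ← map_one (algebraMap K F), dd_algebraMap, map_zero, sub_zero]))
    (fun f g => OrdinaryIDAlgebra.algebraMap_injective (K := K) (F := F) (by
      change algebraMap K F (evlFun K (f * g)) = algebraMap K F (evlFun K f * evlFun K g)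
      have h : f * ii K (dd K g) = ii K (f * dd K g) + ii K (dd K f * ii K (dd K g)) :=
        OrdinaryIDAlgebra.strong_rotaBaxter (K := K) f (dd K g)
      have hg : ii K (dd K g) = g - algebraMap K F (evlFun K g) := by rw [evlFun_spec]; ring
      rw [hg, mul_sub, mul_sub, map_sub, mul_comm (dd K f) (algebraMap K F _),
        ← Algebra.smul_def, map_smul, Algebra.smul_def] at h
      rw [map_mul, evlFun_spec K (f * g), evlFun_spec K f, dd_mul, map_add]
      linear_combination h))

theorem algebraMap_evl (f : F) : algebraMap K F (evl K f) = f - ii K (dd K f) := evlFun_spec K f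

end Evaluation

variable (F)

/-- An ordinary shifted integro-differential algebra: a shift map `c ↦ S_c`, that is a group
homomorphism from `(K, +)` into the `K`-algebra automorphisms, with `[S_c, ∂] = 0` and
`[S_c, ∫] = e_c ∫`, where `e_c = e ∘ S_c`. -/
class OrdinaryShiftedIDAlgebra [Field K] [CommRing F] [Algebra K F]
    extends OrdinaryIDAlgebra K F where
  shift : Multiplicative K →* (F ≃ₐ[K] F)
  shift_der : ∀ (c : K) (f : F),
    shift (Multiplicative.ofAdd c) (der f) = der (shift (Multiplicative.ofAdd c) f)
  shift_int : ∀ (c : K) (f : F),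
    shift (Multiplicative.ofAdd c) (int f) - int (shift (Multiplicative.ofAdd c) f) =
      algebraMap K F (evl K (shift (Multiplicative.ofAdd c) (int f)))

variable {F}

/-- The evaluation `e_c = e ∘ S_c` at the point `c`. -/
def evlAt [Field K] [CommRing F] [Algebra K F] [OrdinaryShiftedIDAlgebra K F] (c : K) :
    F →ₐ[K] K :=
  (evl K).comp
    (OrdinaryShiftedIDAlgebra.shift (K := K) (F := F) (Multiplicative.ofAdd c) : F →ₐ[K] F)

theorem evlAt_zero [Field K] [CommRing F] [Algebra K F] [OrdinaryShiftedIDAlgebra K F] :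
    evlAt K (0 : K) = (evl K : F →ₐ[K] K) := by
  ext f
  change evl K (OrdinaryShiftedIDAlgebra.shift (K := K) (F := F) (Multiplicative.ofAdd 0) f) = _
  rw [ofAdd_zero, map_one]; rfl

/-- The element `e_c(f) ∈ K`, regarded as a constant of `F`. -/
def cst [Field K] [CommRing F] [Algebra K F] [OrdinaryShiftedIDAlgebra K F] (c : K) : F →ₐ[K] F :=
  (Algebra.ofId K F).comp (evlAt K c)

/-! ## The piecewise extension -/

/-- The Heaviside operator `H : K → K` with the left continuous convention `H(0) = 0`. -/
def heav [Field K] [LinearOrder K] (a : K) : K := if 0 < a then 1 else 0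

/-- The dual Heaviside operator `1 - H`. -/
def heavBar [Field K] [LinearOrder K] (a : K) : K := 1 - heav K a

/-- The unitarization of the semigroup `(K, ⊔)`. -/
inductive JoinIdx : Type u
  | one : JoinIdx
  | pt : K → JoinIdx

variable {K} in
/-- The product of the unitarization of `(K, ⊔)`. -/
def JoinIdx.mul [LinearOrder K] : JoinIdx K → JoinIdx K → JoinIdx K
  | .one, t => t
  | .pt a, .one => .pt a
  | .pt a, .pt b => .pt (a ⊔ b)

instance [LinearOrder K] : CommMonoid (JoinIdx K) where
  mul := JoinIdx.mul
  one := .one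
  mul_assoc a b c := by
    cases a <;> cases b <;> cases c <;> first | rfl | exact congrArg JoinIdx.pt (sup_assoc _ _ _)
  one_mul a := rfl
  mul_one a := by cases a <;> rfl
  mul_comm a b := by
    cases a <;> cases b <;> first | rfl | exact congrArg JoinIdx.pt (sup_comm _ _)

variable (F)

/-- The piecewise extension `F[K_⊔]`. -/
abbrev Pcw [CommRing F] : Type (max u v) := MonoidAlgebra F (JoinIdx K)

variable {K} in
/-- The Heaviside element `H_a` of the piecewise extension. -/
def pH [LinearOrder K] [CommRing F] (a : K) : Pcw K F := MonoidAlgebra.single (JoinIdx.pt a) 1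

variable {K} in
/-- The ideal generated by `1 - H_α` and `H_β`. -/
def offInterval [LinearOrder K] [CommRing F] (α β : K) : Ideal (Pcw K F) :=
  Ideal.span {1 - pH F α, pH F β}

variable {K F} in
/-- Equality of piecewise functions on the interval `[α, β]`. -/
def EqOnInterval [LinearOrder K] [CommRing F] (α β : K) (p q : Pcw K F) : Prop :=
  p - q ∈ offInterval F α β

variable [Field K] [LinearOrder K] [CommRing F] [Algebra K F] [OrdinaryShiftedIDAlgebra K F]

variable {K} in
/-- The embedding of `F` into its piecewise extension. -/
def pC : F →ₗ[K] Pcw K F := MonoidAlgebra.lsingle JoinIdx.one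

/-- A linear map on the piecewise extension is given by its values on `f` and on `f H_a`. -/
def pcwLift {M : Type*} [AddCommGroup M] [Module K M] (φ : JoinIdx K → (F →ₗ[K] M)) :
    Pcw K F →ₗ[K] M :=
  (Finsupp.lsum K φ).comp (MonoidAlgebra.coeffLinearEquiv K).toLinearMap

/-- The values of the Rota-Baxter operator of the piecewise extension:
`f ↦ ∫ f` and `f H_a ↦ (∫_a f) H_a + (1 - H(a)) ∫_0^a f`. -/
def pcwIntGen : JoinIdx K → (F →ₗ[K] Pcw K F)
  | .one => pC F ∘ₗ ii K
  | .pt a =>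
      MonoidAlgebra.lsingle (JoinIdx.pt a) ∘ₗ (LinearMap.id - (cst K a).toLinearMap) ∘ₗ ii K
        + heavBar K a • (pC F ∘ₗ (cst K a).toLinearMap ∘ₗ ii K)

/-- The Rota-Baxter operator of the piecewise extension. -/
def pcwInt : Pcw K F →ₗ[K] Pcw K F := pcwLift K F (pcwIntGen K F)

/-- The values of the evaluation at `c` (shift by `c`, then evaluate at `0`): `f ↦ e_c(f)` and
`f H_a ↦ e_c(f) (1 - H(a - c))`. -/
def pcwEvlGen (c : K) : JoinIdx K → (F →ₗ[K] K)
  | .one => (evlAt K c).toLinearMap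
  | .pt a => heavBar K (a - c) • (evlAt K c).toLinearMap

/-- The evaluation at `c` on the piecewise extension. -/
def pcwEvl (c : K) : Pcw K F →ₗ[K] K := pcwLift K F (pcwEvlGen K F c)

/-! ## The distribution module -/

/-- The `F`-basis `1, H_a^(k)` of the module of affine differential polynomials. -/
inductive DistIdx : Type u
  | one : DistIdx
  | heav : K → ℕ → DistIdx

/-- The module `F{H_a | a ∈ K}_1` of affine differential polynomials. -/
abbrev AffDiff : Type (max u v) := DistIdx K →₀ F

/-- The values of the derivation on the affine differential polynomials:
`f ↦ f'` and `f H_a^(k) ↦ f' H_a^(k) + f H_a^(k+1)`. -/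
def affDerGen : DistIdx K → (F →ₗ[K] AffDiff K F)
  | .one => Finsupp.lsingle .one ∘ₗ dd K
  | .heav a k => Finsupp.lsingle (.heav a k) ∘ₗ dd K + Finsupp.lsingle (.heav a (k + 1))

/-- The derivation on the affine differential polynomials. -/
def affDer : AffDiff K F →ₗ[K] AffDiff K F := Finsupp.lsum K (affDerGen K F)

variable {K F} in
/-- The element `f δ_a - e_a(f) δ_a`, where `δ_a = H_a'`. -/
def sift (a : K) (f : F) : AffDiff K F := Finsupp.single (.heav a 1) (f - cst K a f)

/-- The differential `F`-submodule generated by the elements `f δ_a - e_a(f) δ_a`. -/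
def siftRel : Submodule F (AffDiff K F) :=
  sInf {N | (∀ (a : K) (f : F), sift a f ∈ N) ∧ ∀ ω ∈ N, affDer K F ω ∈ N}

/-- The distribution module: the quotient of `F{H_a | a ∈ K}_1` by `siftRel`. -/
abbrev Dist : Type (max u v) := AffDiff K F ⧸ siftRel K F

theorem affDer_single_one (f : F) :
    affDer K F (Finsupp.single .one f) = Finsupp.single .one (dd K f) := by
  simp [affDer, affDerGen]

theorem affDer_single_heav (a : K) (k : ℕ) (f : F) :
    affDer K F (Finsupp.single (.heav a k) f) =
      Finsupp.single (.heav a k) (dd K f) + Finsupp.single (.heav a (k + 1)) f := by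
  simp [affDer, affDerGen]

theorem affDer_smul (f : F) (ω : AffDiff K F) :
    affDer K F (f • ω) = f • affDer K F ω + dd K f • ω := by
  induction ω using Finsupp.induction_linear with
  | zero => simp
  | add p q hp hq => rw [smul_add, map_add, hp, hq, map_add, smul_add, smul_add]; abel
  | single s g =>
    cases s with
    | one =>
      rw [Finsupp.smul_single, affDer_single_one, affDer_single_one, Finsupp.smul_single,
        Finsupp.smul_single, ← Finsupp.single_add, smul_eq_mul, smul_eq_mul, smul_eq_mul, dd_mul]
    | heav a k =>
      rw [Finsupp.smul_single, affDer_single_heav, affDer_single_heav, smul_add,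
        Finsupp.smul_single, Finsupp.smul_single, Finsupp.smul_single, smul_eq_mul, smul_eq_mul,
        smul_eq_mul, dd_mul, Finsupp.single_add]
      abel

theorem sift_mem (a : K) (f : F) : sift a f ∈ siftRel K F := by
  rw [siftRel, Submodule.mem_sInf]
  exact fun N hN => hN.1 a f

theorem affDer_mem {ω : AffDiff K F} (h : ω ∈ siftRel K F) : affDer K F ω ∈ siftRel K F := by
  rw [siftRel, Submodule.mem_sInf] at h ⊢
  exact fun N hN => hN.2 ω (h N hN)

variable {K} in
/-- The values of the Rota-Baxter operator on generators:
`f ↦ ∫ f`, `f H_a ↦ (∫_a f) H_a + (1 - H(a)) ∫_0^a f`, `f δ_a ↦ e_a(f) (H_a - (1 - H(a)))` and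
`f δ_a^(k+1) ↦ f δ_a^(k) - ∫ f' δ_a^(k)`. -/
def affIntHeav (a : K) : ℕ → (F →ₗ[K] AffDiff K F)
  | 0 =>
      Finsupp.lsingle (.heav a 0) ∘ₗ (LinearMap.id - (cst K a).toLinearMap) ∘ₗ ii K
        + heavBar K a • (Finsupp.lsingle .one ∘ₗ (cst K a).toLinearMap ∘ₗ ii K)
  | 1 => (Finsupp.lsingle (.heav a 0) - heavBar K a • Finsupp.lsingle .one)
        ∘ₗ (cst K a).toLinearMap
  | k + 2 => Finsupp.lsingle (.heav a (k + 1)) - affIntHeav a (k + 1) ∘ₗ dd K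

/-- The values of the Rota-Baxter operator on all generators. -/
def affIntGen : DistIdx K → (F →ₗ[K] AffDiff K F)
  | .one => Finsupp.lsingle .one ∘ₗ ii K
  | .heav a k => affIntHeav F a k

/-- The Rota-Baxter operator on the affine differential polynomials. -/
def affInt : AffDiff K F →ₗ[K] AffDiff K F := Finsupp.lsum K (affIntGen K F)

/-- The values of the evaluation at `c`: `f ↦ e_c(f)`, `f H_a ↦ e_c(f) (1 - H(a - c))` and
`f δ_a^(k) ↦ 0`. -/
def affEvlGen (c : K) : DistIdx K → (F →ₗ[K] K)
  | .one => (evlAt K c).toLinearMap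
  | .heav a 0 => heavBar K (a - c) • (evlAt K c).toLinearMap
  | .heav _ (_ + 1) => 0

/-- The evaluation at `c` on the affine differential polynomials. -/
def affEvl (c : K) : AffDiff K F →ₗ[K] K := Finsupp.lsum K (affEvlGen K F c)

theorem affInt_single (s : DistIdx K) (f : F) :
    affInt K F (Finsupp.single s f) = affIntGen K F s f := by
  simp only [affInt, Finsupp.lsum_single]

theorem affEvl_single (c : K) (s : DistIdx K) (f : F) :
    affEvl K F c (Finsupp.single s f) = affEvlGen K F c s f := by
  simp only [affEvl, Finsupp.lsum_single]

/-- The `F`-submodule spanned by the `δ_a^(k)`. -/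
def diracPart : Submodule F (AffDiff K F) :=
  LinearMap.range (Finsupp.lmapDomain F F fun p : K × ℕ => DistIdx.heav p.1 (p.2 + 1))

theorem diracPart_induction {P : AffDiff K F → Prop} (h0 : P 0)
    (hadd : ∀ x y, P x → P y → P (x + y))
    (hs : ∀ (a : K) (k : ℕ) (f : F), P (Finsupp.single (.heav a (k + 1)) f))
    {ω : AffDiff K F} (h : ω ∈ diracPart K F) : P ω := by
  obtain ⟨x, rfl⟩ := h
  induction x using Finsupp.induction_linear with
  | zero => simpa using h0
  | add x y hx hy => rw [map_add]; exact hadd _ _ hx hy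
  | single p f => simpa using hs p.1 p.2 f

theorem single_mem_diracPart (a : K) (k : ℕ) (f : F) :
    (Finsupp.single (.heav a (k + 1)) f : AffDiff K F) ∈ diracPart K F :=
  ⟨Finsupp.single (a, k) f, by simp⟩

theorem affDer_mem_diracPart {ω : AffDiff K F} (h : ω ∈ diracPart K F) :
    affDer K F ω ∈ diracPart K F := by
  refine diracPart_induction K F (P := fun ω => affDer K F ω ∈ diracPart K F) ?_ ?_ ?_ h
  · simp
  · intro x y hx hy
    rw [map_add]
    exact add_mem hx hy
  · intro a k f
    rw [affDer_single_heav]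
    exact add_mem (single_mem_diracPart K F _ _ _) (single_mem_diracPart K F _ _ _)

theorem affInt_affDer {ω : AffDiff K F} (h : ω ∈ diracPart K F) :
    affInt K F (affDer K F ω) = ω := by
  refine diracPart_induction K F (P := fun ω => affInt K F (affDer K F ω) = ω) ?_ ?_ ?_ h
  · simp
  · intro x y hx hy
    rw [map_add, map_add, hx, hy]
  · intro a k f
    rw [affDer_single_heav, map_add, affInt_single, affInt_single, affIntGen, affIntGen,
      affIntHeav, LinearMap.sub_apply, LinearMap.comp_apply]
    simp

theorem affEvl_diracPart (c : K) {ω : AffDiff K F} (h : ω ∈ diracPart K F) :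
    affEvl K F c ω = 0 := by
  refine diracPart_induction K F (P := fun ω => affEvl K F c ω = 0) ?_ ?_ ?_ h
  · simp
  · intro x y hx hy
    rw [map_add, hx, hy, add_zero]
  · intro a k f
    rw [affEvl_single]
    rfl

/-- Auxiliary: the elements of `siftRel` that only involve Diracs and whose multiples are mapped
into `siftRel` by the Rota-Baxter operator. -/
def siftAux : Submodule F (AffDiff K F) where
  carrier := {ω | ω ∈ siftRel K F ∧ ω ∈ diracPart K F ∧
    ∀ f : F, affInt K F (f • ω) ∈ siftRel K F}
  zero_mem' := ⟨zero_mem _, zero_mem _, fun f => by simp⟩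
  add_mem' := fun {x y} hx hy => ⟨add_mem hx.1 hy.1, add_mem hx.2.1 hy.2.1, fun f => by
    rw [smul_add, map_add]
    exact add_mem (hx.2.2 f) (hy.2.2 f)⟩
  smul_mem' := fun g x hx => ⟨Submodule.smul_mem _ g hx.1, Submodule.smul_mem _ g hx.2.1,
    fun f => by
      rw [smul_smul]
      exact hx.2.2 (f * g)⟩

theorem siftRel_le_siftAux : siftRel K F ≤ siftAux K F := by
  refine sInf_le ⟨fun a f => ⟨sift_mem K F a f, single_mem_diracPart K F a 0 _, fun g => ?_⟩,
    fun ω hω => ⟨affDer_mem K F hω.1, affDer_mem_diracPart K F hω.2.1, fun f => ?_⟩⟩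
  · have h : cst K a (g * (f - cst K a f)) = 0 := by
      have hc : cst K a (cst K a f) = cst K a f := by
        change algebraMap K F (evlAt K a (algebraMap K F (evlAt K a f))) = _
        rw [AlgHom.commutes]; rfl
      rw [map_mul, map_sub, hc, sub_self, mul_zero]
    rw [sift, Finsupp.smul_single, smul_eq_mul, affInt_single, affIntGen, affIntHeav,
      LinearMap.comp_apply, AlgHom.toLinearMap_apply, h, map_zero]
    exact zero_mem _
  · have h : f • affDer K F ω = affDer K F (f • ω) - dd K f • ω := by rw [affDer_smul]; abel
    rw [h, map_sub, affInt_affDer K F (Submodule.smul_mem _ f hω.2.1)]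
    exact sub_mem (Submodule.smul_mem _ f hω.1) (hω.2.2 _)

variable {K F} in
/-- The class of an affine differential polynomial in the distribution module. -/
def Dist.mk : AffDiff K F →ₗ[K] Dist K F := (siftRel K F).mkQ.restrictScalars K

variable {K} in
/-- The Heaviside element `H_a` and its derivatives `H_a^(k)`, so that `δ_a^(k) = H_a^(k+1)`. -/
def dH (a : K) (k : ℕ) : Dist K F := Dist.mk (Finsupp.single (.heav a k) 1)

/-- A `K`-linear map on the affine differential polynomials that annihilates `siftRel` descends
to the distribution module. -/
def Dist.lift {M : Type*} [AddCommGroup M] [Module K M] (φ : AffDiff K F →ₗ[K] M)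
    (h : ∀ ω ∈ siftRel K F, φ ω = 0) : Dist K F →ₗ[K] M :=
  Submodule.liftQ ((siftRel K F).restrictScalars K) φ h

/-- The derivation of the distribution module. -/
def distDer : Dist K F →ₗ[K] Dist K F :=
  Dist.lift K F (Dist.mk ∘ₗ affDer K F) fun ω h =>
    show (Dist.mk ∘ₗ affDer K F) ω = 0 from
      (Submodule.Quotient.mk_eq_zero _).2 (affDer_mem K F h)

/-- The Rota-Baxter operator of the distribution module. -/
def distInt : Dist K F →ₗ[K] Dist K F :=
  Dist.lift K F (Dist.mk ∘ₗ affInt K F) fun ω h =>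
    show (Dist.mk ∘ₗ affInt K F) ω = 0 from
      (Submodule.Quotient.mk_eq_zero _).2 (by simpa using (siftRel_le_siftAux K F h).2.2 1)

/-- The evaluation at `c` on the distribution module. -/
def distEvl (c : K) : Dist K F →ₗ[K] K :=
  Dist.lift K F (affEvl K F c) fun _ h => affEvl_diracPart K F c (siftRel_le_siftAux K F h).2.1

/-- The index of `H_a` in the basis of the affine differential polynomials. -/
def JoinIdx.toDist : JoinIdx K → DistIdx K
  | .one => .one
  | .pt a => .heav a 0

/-- The embedding of the piecewise extension into the distribution module. -/
def pcwToDist : Pcw K F →ₗ[K] Dist K F :=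
  pcwLift K F fun s => Dist.mk ∘ₗ Finsupp.lsingle (JoinIdx.toDist K s)

theorem pcwLift_single {M : Type*} [AddCommGroup M] [Module K M] (φ : JoinIdx K → (F →ₗ[K] M))
    (s : JoinIdx K) (f : F) : pcwLift K F φ (MonoidAlgebra.single s f) = φ s f :=
  Finsupp.lsum_single (S := K) φ s f

theorem Dist.lift_mk {M : Type*} [AddCommGroup M] [Module K M] (φ : AffDiff K F →ₗ[K] M)
    (h : ∀ ω ∈ siftRel K F, φ ω = 0) (ω : AffDiff K F) :
    Dist.lift K F φ h (Dist.mk ω) = φ ω := rfl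

theorem pcw_hom_ext {M : Type*} [AddCommGroup M] [Module K M] {φ ψ : Pcw K F →ₗ[K] M}
    (h : ∀ (s : JoinIdx K) (f : F),
      φ (MonoidAlgebra.single s f) = ψ (MonoidAlgebra.single s f)) : φ = ψ := by
  refine LinearMap.ext fun p => ?_
  induction p using MonoidAlgebra.induction_linear with
  | zero => simp
  | add x y hx hy => rw [map_add, map_add, hx, hy]
  | single s f => exact h s f

theorem pcwToDist_single (s : JoinIdx K) (f : F) :
    pcwToDist K F (MonoidAlgebra.single s f) = Dist.mk (Finsupp.single (JoinIdx.toDist K s) f) :=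
  pcwLift_single K F _ s f

theorem distInt_pcwToDist : distInt K F ∘ₗ pcwToDist K F = pcwToDist K F ∘ₗ pcwInt K F := by
  refine pcw_hom_ext K F fun s f => ?_
  rw [LinearMap.comp_apply, LinearMap.comp_apply, pcwToDist_single, distInt, Dist.lift_mk,
    LinearMap.comp_apply, affInt_single, pcwInt, pcwLift_single]
  cases s with
  | one => exact (pcwToDist_single K F JoinIdx.one (ii K f)).symm
  | pt a =>
    simp only [pcwIntGen, JoinIdx.toDist, affIntGen, affIntHeav, LinearMap.add_apply,
      LinearMap.smul_apply, LinearMap.comp_apply, map_add, map_smul, pC,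
      MonoidAlgebra.lsingle_apply, pcwToDist_single, Finsupp.lsingle_apply]

theorem distEvl_pcwToDist (c : K) : distEvl K F c ∘ₗ pcwToDist K F = pcwEvl K F c := by
  refine pcw_hom_ext K F fun s f => ?_
  rw [LinearMap.comp_apply, pcwToDist_single, distEvl, Dist.lift_mk, affEvl_single, pcwEvl,
    pcwLift_single]
  cases s <;> rfl

/-- Multiplication by `f ∈ F`, as a `K`-linear map on an `F`-module. -/
abbrev mulBy (M : Type*) [AddCommGroup M] [Module K M] [Module F M] [IsScalarTower K F M] (f : F) :
    M →ₗ[K] M := Algebra.lsmul K K M f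

theorem mulBy_pcwToDist (f : F) :
    mulBy K F (Dist K F) f ∘ₗ pcwToDist K F = pcwToDist K F ∘ₗ mulBy K F (Pcw K F) f := by
  refine pcw_hom_ext K F fun s g => ?_
  rw [LinearMap.comp_apply, LinearMap.comp_apply, pcwToDist_single, Algebra.lsmul_apply,
    Algebra.lsmul_apply, MonoidAlgebra.smul_single, pcwToDist_single, ← Finsupp.smul_single]
  rfl

/-! ## Bivariate distributions

The first tensor factor is the variable `x`, the second one is `ξ`. -/

/-- The bivariate piecewise extension `P_xξ = P_x ⊗ P_ξ`. -/
abbrev PcwBi : Type (max u v) := Pcw K F ⊗[K] Pcw K F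

instance : AddCommMonoid (PcwBi K F) := TensorProduct.addCommMonoid

instance : AddCommGroup (PcwBi K F) := TensorProduct.addCommGroup

/-- The two copies of `P_xξ` in `D_x ⊗ P_ξ` and `P_x ⊗ D_ξ` that are identified. -/
def glueMap : PcwBi K F →ₗ[K] (Dist K F ⊗[K] Pcw K F) × (Pcw K F ⊗[K] Dist K F) :=
  (LinearMap.rTensor (Pcw K F) (pcwToDist K F)).prod
    (-LinearMap.lTensor (Pcw K F) (pcwToDist K F))

/-- The tensorial distribution module `D_xξ`: the sum of `D_x ⊗ P_ξ` and `P_x ⊗ D_ξ`, with the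
two copies of `P_xξ` identified. -/
abbrev TensDist : Type (max u v) :=
  ((Dist K F ⊗[K] Pcw K F) × (Pcw K F ⊗[K] Dist K F)) ⧸ LinearMap.range (glueMap K F)

/-- The summand `D_x ⊗ P_ξ` in `D_xξ`. -/
def tensL : Dist K F ⊗[K] Pcw K F →ₗ[K] TensDist K F :=
  (LinearMap.range (glueMap K F)).mkQ ∘ₗ LinearMap.inl K _ _

/-- The summand `P_x ⊗ D_ξ` in `D_xξ`. -/
def tensR : Pcw K F ⊗[K] Dist K F →ₗ[K] TensDist K F :=
  (LinearMap.range (glueMap K F)).mkQ ∘ₗ LinearMap.inr K _ _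

/-- The embedding of `P_xξ` into `D_xξ`. -/
def tensP : PcwBi K F →ₗ[K] TensDist K F :=
  tensL K F ∘ₗ LinearMap.rTensor (Pcw K F) (pcwToDist K F)

theorem tensP_eq (p : PcwBi K F) :
    tensP K F p = tensR K F (LinearMap.lTensor (Pcw K F) (pcwToDist K F) p) := by
  refine (Submodule.Quotient.eq _).2 ⟨p, ?_⟩
  simp [glueMap]

/-- Linear maps out of `D_xξ`. -/
def TensDist.lift {M : Type*} [AddCommGroup M] [Module K M] (φ : Dist K F ⊗[K] Pcw K F →ₗ[K] M)
    (ψ : Pcw K F ⊗[K] Dist K F →ₗ[K] M)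
    (h : φ ∘ₗ LinearMap.rTensor (Pcw K F) (pcwToDist K F) =
      ψ ∘ₗ LinearMap.lTensor (Pcw K F) (pcwToDist K F)) : TensDist K F →ₗ[K] M :=
  Submodule.liftQ _ (φ.coprod ψ) (by
    rintro _ ⟨p, rfl⟩
    have := LinearMap.congr_fun h p
    simp only [LinearMap.comp_apply] at this
    simp [glueMap, this])

theorem TensDist.lift_tensL {M : Type*} [AddCommGroup M] [Module K M]
    (φ : Dist K F ⊗[K] Pcw K F →ₗ[K] M) (ψ : Pcw K F ⊗[K] Dist K F →ₗ[K] M)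
    (h : φ ∘ₗ LinearMap.rTensor (Pcw K F) (pcwToDist K F) =
      ψ ∘ₗ LinearMap.lTensor (Pcw K F) (pcwToDist K F)) (t : Dist K F ⊗[K] Pcw K F) :
    TensDist.lift K F φ ψ h (tensL K F t) = φ t := by
  change (φ.coprod ψ) (t, 0) = φ t
  simp

theorem TensDist.lift_tensR {M : Type*} [AddCommGroup M] [Module K M]
    (φ : Dist K F ⊗[K] Pcw K F →ₗ[K] M) (ψ : Pcw K F ⊗[K] Dist K F →ₗ[K] M)
    (h : φ ∘ₗ LinearMap.rTensor (Pcw K F) (pcwToDist K F) =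
      ψ ∘ₗ LinearMap.lTensor (Pcw K F) (pcwToDist K F)) (t : Pcw K F ⊗[K] Dist K F) :
    TensDist.lift K F φ ψ h (tensR K F t) = ψ t := by
  change (φ.coprod ψ) (0, t) = ψ t
  simp

theorem TensDist.lift_tensP {M : Type*} [AddCommGroup M] [Module K M]
    (φ : Dist K F ⊗[K] Pcw K F →ₗ[K] M) (ψ : Pcw K F ⊗[K] Dist K F →ₗ[K] M)
    (h : φ ∘ₗ LinearMap.rTensor (Pcw K F) (pcwToDist K F) =
      ψ ∘ₗ LinearMap.lTensor (Pcw K F) (pcwToDist K F)) (p : PcwBi K F) :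
    TensDist.lift K F φ ψ h (tensP K F p) =
      φ (LinearMap.rTensor (Pcw K F) (pcwToDist K F) p) :=
  TensDist.lift_tensL K F φ ψ h _

/-- Multiplication by `u(x) v(ξ)` on `D_xξ`. -/
def tensMul (f g : F) : TensDist K F →ₗ[K] TensDist K F :=
  TensDist.lift K F
    (tensL K F ∘ₗ TensorProduct.map (mulBy K F (Dist K F) f) (mulBy K F (Pcw K F) g))
    (tensR K F ∘ₗ TensorProduct.map (mulBy K F (Pcw K F) f) (mulBy K F (Dist K F) g))
    (by
      refine TensorProduct.ext' fun p q => ?_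
      have h1 := LinearMap.congr_fun (mulBy_pcwToDist K F f) p
      have h2 := LinearMap.congr_fun (mulBy_pcwToDist K F g) q
      simp only [LinearMap.comp_apply] at h1 h2
      simp only [LinearMap.comp_apply, LinearMap.rTensor_tmul, LinearMap.lTensor_tmul,
        TensorProduct.map_tmul, h1, h2]
      exact tensP_eq K F (_ ⊗ₜ[K] _))

/-- The Rota-Baxter operator `∫^ξ` on `D_xξ`, where the `x`-factors are constants. -/
def tensInt : TensDist K F →ₗ[K] TensDist K F :=
  TensDist.lift K F
    (tensL K F ∘ₗ LinearMap.lTensor (Dist K F) (pcwInt K F))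
    (tensR K F ∘ₗ LinearMap.lTensor (Pcw K F) (distInt K F))
    (by
      refine TensorProduct.ext' fun p q => ?_
      have h2 := LinearMap.congr_fun (distInt_pcwToDist K F) q
      simp only [LinearMap.comp_apply] at h2
      simp only [LinearMap.comp_apply, LinearMap.rTensor_tmul, LinearMap.lTensor_tmul, h2]
      exact tensP_eq K F (_ ⊗ₜ[K] _))

/-- The evaluation at `ξ = c` on `D_xξ`, with values in the distributions in `x`. -/
def tensEvl (c : K) : TensDist K F →ₗ[K] Dist K F :=
  TensDist.lift K F
    ((TensorProduct.rid K (Dist K F)).toLinearMap ∘ₗ LinearMap.lTensor (Dist K F) (pcwEvl K F c))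
    (pcwToDist K F ∘ₗ (TensorProduct.rid K (Pcw K F)).toLinearMap ∘ₗ
      LinearMap.lTensor (Pcw K F) (distEvl K F c))
    (by
      refine TensorProduct.ext' fun p q => ?_
      have h2 := LinearMap.congr_fun (distEvl_pcwToDist K F c) q
      simp only [LinearMap.comp_apply] at h2
      simp [h2])

/-- The `K`-space generated by the diagonal Heaviside function `H(x-ξ)` and its derivatives. -/
abbrev SlimDist : Type u := ℕ →₀ K

/-- The relation `(H_a(x) - H_a(ξ)) H^(n)(x-ξ) = H_a(x) (1 - H_a(ξ))` for `n = 0`, and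
`(H_a(x) - H_a(ξ)) H^(n)(x-ξ) = 0` for `n > 0`, multiplied by `p ∈ P_xξ`. The element
`q H^(n)(x-ξ)` with `q ∈ P_xξ` is represented by `q ⊗ Finsupp.single n 1`. -/
def diagGen (p : PcwBi K F) (a : K) (n : ℕ) : TensDist K F × (PcwBi K F ⊗[K] SlimDist K) :=
  (if n = 0 then -tensP K F (p * (pH F a ⊗ₜ[K] (1 - pH F a))) else 0,
    (p * (pH F a ⊗ₜ[K] 1 - 1 ⊗ₜ[K] pH F a)) ⊗ₜ[K] Finsupp.single n 1)

/-- The submodule of relations for the diagonal Heavisides. -/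
def diagRel : Submodule K (TensDist K F × (PcwBi K F ⊗[K] SlimDist K)) :=
  Submodule.span K {z | ∃ p a n, z = diagGen K F p a n}

/-- The bivariate distribution module `D_2`: the tensorial distribution module together with the
diagonal Heaviside function `H(x-ξ)` and its derivatives, with coefficients in `P_xξ`, modulo the
relations `diagRel`. -/
abbrev DistBi : Type (max u v) := (TensDist K F × (PcwBi K F ⊗[K] SlimDist K)) ⧸ diagRel K F

/-- The tensorial distributions inside `D_2`. -/
def biT : TensDist K F →ₗ[K] DistBi K F := (diagRel K F).mkQ ∘ₗ LinearMap.inl K _ _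

/-- The element `p H^(n)(x-ξ)` of `D_2`, for `p ∈ P_xξ`. -/
def biD (n : ℕ) : PcwBi K F →ₗ[K] DistBi K F :=
  (diagRel K F).mkQ ∘ₗ LinearMap.inr K _ _ ∘ₗ
    (TensorProduct.mk K (PcwBi K F) (SlimDist K)).flip (Finsupp.single n 1)

/-- The embedding of the distributions in `x` into `D_2`. -/
def distX : Dist K F →ₗ[K] DistBi K F :=
  biT K F ∘ₗ tensL K F ∘ₗ (TensorProduct.mk K (Dist K F) (Pcw K F)).flip 1

/-- The embedding of the distributions in `ξ` into `D_2`. -/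
def distXi : Dist K F →ₗ[K] DistBi K F :=
  biT K F ∘ₗ tensR K F ∘ₗ TensorProduct.mk K (Pcw K F) (Dist K F) 1

theorem biD_rel (p : PcwBi K F) (a : K) (n : ℕ) :
    biD K F n (p * (pH F a ⊗ₜ[K] 1 - 1 ⊗ₜ[K] pH F a)) =
      if n = 0 then biT K F (tensP K F (p * (pH F a ⊗ₜ[K] (1 - pH F a)))) else 0 := by
  have h : (diagRel K F).mkQ (diagGen K F p a n) = 0 :=
    (Submodule.Quotient.mk_eq_zero _).2 (Submodule.subset_span ⟨p, a, n, rfl⟩)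
  have h2 : diagGen K F p a n = LinearMap.inl K _ _ (diagGen K F p a n).1 +
      LinearMap.inr K _ _ ((p * (pH F a ⊗ₜ[K] 1 - 1 ⊗ₜ[K] pH F a)) ⊗ₜ[K]
        Finsupp.single n 1) := by
    simp [diagGen]
  rw [h2, map_add] at h
  have h3 : biT K F (diagGen K F p a n).1 +
    biD K F n (p * (pH F a ⊗ₜ[K] 1 - 1 ⊗ₜ[K] pH F a)) = 0 := h
  rw [← neg_eq_iff_add_eq_zero, diagGen] at h3
  rw [← h3]
  split_ifs <;> simp

/-- Linear maps out of `P_xξ ⊗ K{H^(n)(x-ξ)}`. -/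
def diagLift {M : Type*} [AddCommGroup M] [Module K M] (ψ : ℕ → (PcwBi K F →ₗ[K] M)) :
    PcwBi K F ⊗[K] SlimDist K →ₗ[K] M :=
  TensorProduct.lift (Finsupp.lsum K fun n => LinearMap.toSpanSingleton K _ (ψ n)).flip

theorem diagLift_tmul {M : Type*} [AddCommGroup M] [Module K M] (ψ : ℕ → (PcwBi K F →ₗ[K] M))
    (n : ℕ) (p : PcwBi K F) : diagLift K F ψ (p ⊗ₜ[K] Finsupp.single n 1) = ψ n p := by
  simp [diagLift]

/-- Linear maps out of `D_2`. -/
def DistBi.lift {M : Type*} [AddCommGroup M] [Module K M] (φ : TensDist K F →ₗ[K] M)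
    (ψ : ℕ → (PcwBi K F →ₗ[K] M))
    (h : ∀ p a n, ψ n (p * (pH F a ⊗ₜ[K] 1 - 1 ⊗ₜ[K] pH F a)) =
      if n = 0 then φ (tensP K F (p * (pH F a ⊗ₜ[K] (1 - pH F a)))) else 0) :
    DistBi K F →ₗ[K] M :=
  Submodule.liftQ _ (φ.coprod (diagLift K F ψ)) (by
    rw [diagRel, Submodule.span_le]
    rintro _ ⟨p, a, n, rfl⟩
    change (φ.coprod (diagLift K F ψ)) (diagGen K F p a n) = 0
    rw [LinearMap.coprod_apply, diagGen, diagLift_tmul, h]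
    split_ifs <;> simp)

/-- Multiplication by `u(x) v(ξ)` on `P_xξ`. -/
def pcwBiMul (f g : F) : PcwBi K F →ₗ[K] PcwBi K F :=
  TensorProduct.map (mulBy K F (Pcw K F) f) (mulBy K F (Pcw K F) g)

theorem pcwBiMul_mul (f g : F) (p q : PcwBi K F) :
    pcwBiMul K F f g (p * q) = pcwBiMul K F f g p * q := by
  have h : pcwBiMul K F f g =
      LinearMap.mulLeft K ((f • (1 : Pcw K F)) ⊗ₜ[K] (g • (1 : Pcw K F))) := by
    refine TensorProduct.ext' fun p q => ?_
    simp [pcwBiMul]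
  rw [h]
  simp [mul_assoc]

theorem tensMul_tensP (f g : F) (p : PcwBi K F) :
    tensMul K F f g (tensP K F p) = tensP K F (pcwBiMul K F f g p) := by
  rw [tensMul, TensDist.lift_tensP]
  induction p using TensorProduct.induction_on with
  | zero => simp
  | add x y hx hy => simp only [map_add, hx, hy]
  | tmul p q =>
    have h1 := LinearMap.congr_fun (mulBy_pcwToDist K F f) p
    simp only [LinearMap.comp_apply] at h1
    simp [tensP, pcwBiMul, h1]

/-- Multiplication by `u(x) v(ξ)` on `D_2`, for `u, v ∈ F`. -/
def biMul (f g : F) : DistBi K F →ₗ[K] DistBi K F :=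
  DistBi.lift K F (biT K F ∘ₗ tensMul K F f g) (fun n => biD K F n ∘ₗ pcwBiMul K F f g)
    (fun p a n => by
      rw [LinearMap.comp_apply, LinearMap.comp_apply, pcwBiMul_mul, biD_rel, tensMul_tensP,
        pcwBiMul_mul])

theorem DistBi.lift_biT {M : Type*} [AddCommGroup M] [Module K M] (φ : TensDist K F →ₗ[K] M)
    (ψ : ℕ → (PcwBi K F →ₗ[K] M))
    (h : ∀ p a n, ψ n (p * (pH F a ⊗ₜ[K] 1 - 1 ⊗ₜ[K] pH F a)) =
      if n = 0 then φ (tensP K F (p * (pH F a ⊗ₜ[K] (1 - pH F a)))) else 0) (t : TensDist K F) :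
    DistBi.lift K F φ ψ h (biT K F t) = φ t := by
  change (φ.coprod (diagLift K F ψ)) (t, 0) = φ t
  simp

theorem DistBi.lift_biD {M : Type*} [AddCommGroup M] [Module K M] (φ : TensDist K F →ₗ[K] M)
    (ψ : ℕ → (PcwBi K F →ₗ[K] M))
    (h : ∀ p a n, ψ n (p * (pH F a ⊗ₜ[K] 1 - 1 ⊗ₜ[K] pH F a)) =
      if n = 0 then φ (tensP K F (p * (pH F a ⊗ₜ[K] (1 - pH F a)))) else 0)
    (n : ℕ) (p : PcwBi K F) : DistBi.lift K F φ ψ h (biD K F n p) = ψ n p := by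
  change (φ.coprod (diagLift K F ψ)) (0, p ⊗ₜ[K] Finsupp.single n 1) = ψ n p
  rw [LinearMap.coprod_apply, map_zero, zero_add, diagLift_tmul]

/-- The integral `∫^ξ p(x) f(ξ) H^(n)(x-ξ)` for `p ∈ P_x` and `f ∈ F`, defined by
`∫^ξ f(ξ) H(x-ξ) = (∫_x^ξ f(ξ)) H(x-ξ) + (∫^x f(ξ)) H_0(x)`, where `∫_x^ξ f(ξ)` is the difference
of the copies of `∫ f` in the variables `ξ` and `x`, and by
`-∫^ξ f(ξ) H^(n+1)(x-ξ) = f(ξ) H^(n)(x-ξ) - ∫^ξ f'(ξ) H^(n)(x-ξ)`; the `x`-factors are constants. -/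
def diagIntBase : ℕ → (F →ₗ[K] Pcw K F →ₗ[K] DistBi K F)
  | 0 => LinearMap.mk₂ K
      (fun f p => biD K F 0 (p ⊗ₜ[K] pC F (ii K f) - (ii K f • p) ⊗ₜ[K] 1)
        + biT K F (tensP K F ((ii K f • (p * pH F 0)) ⊗ₜ[K] 1)))
      (fun f g p => by
        simp only [map_add, add_smul, TensorProduct.tmul_add, TensorProduct.add_tmul, map_sub]
        abel)
      (fun c f p => by
        simp only [map_smul, smul_assoc, TensorProduct.tmul_smul, ← TensorProduct.smul_tmul',
          ← smul_sub, ← smul_add])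
      (fun f p q => by
        simp only [map_add, smul_add, add_mul, TensorProduct.add_tmul, map_sub]
        abel)
      (fun c f p => by
        simp only [smul_comm _ c, smul_mul_assoc, ← TensorProduct.smul_tmul', ← smul_sub, map_smul,
          ← smul_add])
  | n + 1 => diagIntBase n ∘ₗ dd K -
      LinearMap.mk₂ K (fun f p => biD K F n (p ⊗ₜ[K] pC F f))
        (fun f g p => by simp only [map_add, TensorProduct.tmul_add])
        (fun c f p => by simp only [map_smul, TensorProduct.tmul_smul])
        (fun f p q => by simp only [map_add, TensorProduct.add_tmul])
        (fun c f p => by simp only [← TensorProduct.smul_tmul', map_smul])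

/-- The map `(p, q) ↦ p(x) q(ξ)` from `P_x` and `P_ξ` into `D_2`. -/
def biPair : Pcw K F →ₗ[K] Pcw K F →ₗ[K] DistBi K F :=
  (TensorProduct.mk K (Pcw K F) (Pcw K F)).compr₂ (biT K F ∘ₗ tensP K F)

/-- The integral `∫^ξ p(x) q(ξ) H^(n)(x-ξ)` for `q = f` or `q = f H_a`. In the second case,
`H_a(ξ) H^(n)(x-ξ)` is replaced by `H_a(x) H^(n)(x-ξ) - H_a(x) (1 - H_a(ξ))` for `n = 0` and by
`H_a(x) H^(n)(x-ξ)` for `n > 0`. -/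
def diagIntGen (n : ℕ) : JoinIdx K → (F →ₗ[K] Pcw K F →ₗ[K] DistBi K F)
  | .one => diagIntBase K F n
  | .pt a =>
      (diagIntBase K F n - if n = 0 then
        (biPair K F).flip ∘ₗ pcwInt K F ∘ₗ LinearMap.mulRight K (1 - pH F a) ∘ₗ pC F
        else 0).compl₂ (LinearMap.mulRight K (pH F a))

/-- The Rota-Baxter operator `∫^ξ` on the elements `p H^(n)(x-ξ)` with `p ∈ P_xξ`. -/
def diagInt (n : ℕ) : PcwBi K F →ₗ[K] DistBi K F :=
  TensorProduct.lift (pcwLift K F (diagIntGen K F n)).flip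

theorem diagInt_tmul_single (n : ℕ) (p : Pcw K F) (s : JoinIdx K) (f : F) :
    diagInt K F n (p ⊗ₜ[K] MonoidAlgebra.single s f) = diagIntGen K F n s f p := by
  rw [diagInt, TensorProduct.lift.tmul, LinearMap.flip_apply, pcwLift_single]

theorem diagIntGen_pt (n : ℕ) (a : K) (f : F) (p : Pcw K F) :
    diagIntGen K F n (.pt a) f p = diagIntBase K F n f (p * pH F a) - if n = 0 then
      biPair K F (p * pH F a) (pcwInt K F (pC F f * (1 - pH F a))) else 0 := by
  rw [diagIntGen, LinearMap.compl₂_apply, LinearMap.sub_apply, LinearMap.sub_apply]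
  split_ifs <;> rfl

theorem pH_mul_pH (a b : K) : pH F a * pH F b = pH F (a ⊔ b) := by
  rw [pH, pH, pH, MonoidAlgebra.single_mul_single, mul_one]
  rfl

theorem pC_mul_pH (f : F) (a : K) :
    pC F f * pH F a = MonoidAlgebra.single (JoinIdx.pt a) f := by
  rw [pH, pC, MonoidAlgebra.lsingle_apply, MonoidAlgebra.single_mul_single, mul_one]
  rfl

theorem single_pt_mul_pH (f : F) (a b : K) :
    MonoidAlgebra.single (JoinIdx.pt a) f * pH F b =
      MonoidAlgebra.single (JoinIdx.pt (a ⊔ b)) f := by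
  rw [← pC_mul_pH, mul_assoc, pH_mul_pH, pC_mul_pH]

theorem pcwBi_induction {P : PcwBi K F → Prop} (h0 : P 0) (hadd : ∀ x y, P x → P y → P (x + y))
    (hs : ∀ (p : Pcw K F) (s : JoinIdx K) (f : F), P (p ⊗ₜ[K] MonoidAlgebra.single s f))
    (p : PcwBi K F) : P p := by
  induction p using TensorProduct.induction_on with
  | zero => exact h0
  | add x y hx hy => exact hadd _ _ hx hy
  | tmul p q =>
    induction q using MonoidAlgebra.induction_linear with
    | zero => rw [TensorProduct.tmul_zero]; exact h0
    | add x y hx hy => rw [TensorProduct.tmul_add]; exact hadd _ _ hx hy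
    | single s f => exact hs p s f

theorem tensInt_tensP (p q : Pcw K F) :
    (biT K F ∘ₗ tensInt K F) (tensP K F (p ⊗ₜ[K] q)) = biPair K F p (pcwInt K F q) := by
  rw [LinearMap.comp_apply, tensInt, TensDist.lift_tensP]
  simp [tensP, biPair]

theorem tensEvl_tensP (c : K) (p q : Pcw K F) :
    tensEvl K F c (tensP K F (p ⊗ₜ[K] q)) = pcwEvl K F c q • pcwToDist K F p := by
  rw [tensEvl, TensDist.lift_tensP]
  simp

theorem pcwInt_pt_mul (p : Pcw K F) (a b : K) (f : F) :
    biPair K F (p * pH F (b ⊔ a)) (pcwInt K F (pC F f * (1 - pH F (b ⊔ a)))) =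
      biPair K F (p * pH F (b ⊔ a)) (pcwInt K F (pC F f * (1 - pH F b))) +
      biPair K F (p * pH F a)
        (pcwInt K F (MonoidAlgebra.single (JoinIdx.pt b) f * (1 - pH F a))) := by
  rcases le_total a b with h | h
  · have e : MonoidAlgebra.single (JoinIdx.pt b) f * (1 - pH F a) = 0 := by
      rw [mul_sub, mul_one, single_pt_mul_pH, sup_eq_left.2 h, sub_self]
    rw [e, map_zero, map_zero, add_zero, sup_eq_left.2 h]
  · have e : pC F f * (1 - pH F a) = pC F f * (1 - pH F b) +
        MonoidAlgebra.single (JoinIdx.pt b) f * (1 - pH F a) := by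
      rw [mul_sub, mul_one, pC_mul_pH, mul_sub, mul_one, pC_mul_pH, mul_sub, mul_one,
        single_pt_mul_pH, sup_eq_right.2 h, add_sub, sub_add_cancel]
    rw [sup_eq_right.2 h, e, map_add, map_add]

theorem diagInt_rel_pt (p : Pcw K F) (a b : K) (f : F) (n : ℕ) :
    diagInt K F n ((p * pH F a) ⊗ₜ[K] MonoidAlgebra.single (JoinIdx.pt b) f) -
      diagInt K F n (p ⊗ₜ[K] MonoidAlgebra.single (JoinIdx.pt (b ⊔ a)) f) =
      if n = 0 then biPair K F (p * pH F a)
        (pcwInt K F (MonoidAlgebra.single (JoinIdx.pt b) f * (1 - pH F a))) else 0 := by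
  have e0 : p * pH F a * pH F b = p * pH F (b ⊔ a) := by
    rw [mul_assoc, pH_mul_pH, sup_comm]
  rw [diagInt_tmul_single K F n (p * pH F a), diagInt_tmul_single K F n p,
    diagIntGen_pt K F n b, diagIntGen_pt K F n (b ⊔ a), e0]
  by_cases hn : n = 0
  · rw [if_pos hn, if_pos hn, if_pos hn, pcwInt_pt_mul K F p a b f, sub_sub_sub_cancel_left,
      add_sub_cancel_left]
  · simp only [if_neg hn, sub_zero, sub_self]

theorem diagInt_rel (p : PcwBi K F) (a : K) (n : ℕ) :
    diagInt K F n (p * (pH F a ⊗ₜ[K] 1 - 1 ⊗ₜ[K] pH F a)) = if n = 0 then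
      (biT K F ∘ₗ tensInt K F) (tensP K F (p * (pH F a ⊗ₜ[K] (1 - pH F a)))) else 0 := by
  refine pcwBi_induction K F (P := fun p =>
    diagInt K F n (p * (pH F a ⊗ₜ[K] 1 - 1 ⊗ₜ[K] pH F a)) = if n = 0 then
      (biT K F ∘ₗ tensInt K F) (tensP K F (p * (pH F a ⊗ₜ[K] (1 - pH F a)))) else 0) ?_ ?_ ?_ p
  · simp
  · intro x y hx hy
    simp only [add_mul, map_add, hx, hy]
    split_ifs <;> simp
  · intro p s f
    rw [mul_sub, Algebra.TensorProduct.tmul_mul_tmul, Algebra.TensorProduct.tmul_mul_tmul,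
      Algebra.TensorProduct.tmul_mul_tmul, mul_one, mul_one, map_sub, tensInt_tensP]
    cases s with
    | one =>
      have h1 : (MonoidAlgebra.single JoinIdx.one f : Pcw K F) = pC F f := rfl
      rw [h1, pC_mul_pH, ← h1, diagInt_tmul_single, diagInt_tmul_single, diagIntGen_pt, h1]
      simp [diagIntGen]
    | pt b =>
      rw [single_pt_mul_pH K F f b a]
      exact diagInt_rel_pt K F p a b f n

/-- The Rota-Baxter operator `∫^ξ` of the bivariate distribution module. -/
def biInt : DistBi K F →ₗ[K] DistBi K F :=
  DistBi.lift K F (biT K F ∘ₗ tensInt K F) (diagInt K F) (diagInt_rel K F)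

/-- The evaluation at `ξ = c` on the elements `p H^(n)(x-ξ)`: it sends `p(x) q(ξ) H(x-ξ)` to
`e_c(q) p(x) H_c(x)`, and it annihilates `p(x) q(ξ) H^(n)(x-ξ)` for `n > 0`. -/
def diagEvl (c : K) : ℕ → (PcwBi K F →ₗ[K] Dist K F)
  | 0 => pcwToDist K F ∘ₗ LinearMap.mulRight K (pH F c) ∘ₗ
      (TensorProduct.rid K (Pcw K F)).toLinearMap ∘ₗ LinearMap.lTensor (Pcw K F) (pcwEvl K F c)
  | _ + 1 => 0

theorem diagEvl_tmul (c : K) (p q : Pcw K F) :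
    diagEvl K F c 0 (p ⊗ₜ[K] q) = pcwEvl K F c q • pcwToDist K F (p * pH F c) := by
  simp [diagEvl]

theorem pcwEvl_mul_pH [IsStrictOrderedRing K] (c a : K) (q : Pcw K F) :
    pcwEvl K F c (q * pH F a) = if a ≤ c then pcwEvl K F c q else 0 := by
  have hb : ∀ b : K, heavBar K (b - c) = if b ≤ c then 1 else 0 := by
    intro b
    by_cases h : b ≤ c
    · simp [heavBar, heav, h, not_lt.2 h]
    · simp [heavBar, heav, h, not_le.1 h]
  induction q using MonoidAlgebra.induction_linear with
  | zero => simp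
  | add x y hx hy =>
    rw [add_mul, map_add, hx, hy, map_add]
    split_ifs <;> simp
  | single s f =>
    cases s with
    | one =>
      have h1 : (MonoidAlgebra.single JoinIdx.one f : Pcw K F) = pC F f := rfl
      rw [h1, pC_mul_pH, ← h1, pcwEvl, pcwLift_single, pcwLift_single, pcwEvlGen, pcwEvlGen, hb]
      split_ifs <;> simp
    | pt b =>
      rw [single_pt_mul_pH, pcwEvl, pcwLift_single, pcwLift_single, pcwEvlGen, pcwEvlGen, hb, hb]
      by_cases h1 : a ≤ c <;> by_cases h2 : b ≤ c <;> simp [h1, h2]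

theorem diagEvl_rel [IsStrictOrderedRing K] (c : K) (p : PcwBi K F) (a : K) (n : ℕ) :
    diagEvl K F c n (p * (pH F a ⊗ₜ[K] 1 - 1 ⊗ₜ[K] pH F a)) = if n = 0 then
      tensEvl K F c (tensP K F (p * (pH F a ⊗ₜ[K] (1 - pH F a)))) else 0 := by
  cases n with
  | succ n => simp [diagEvl]
  | zero =>
    rw [if_pos rfl]
    induction p using TensorProduct.induction_on with
    | zero => simp
    | add x y hx hy => rw [add_mul, add_mul, map_add, map_add, map_add, hx, hy]
    | tmul p q =>
      rw [mul_sub, Algebra.TensorProduct.tmul_mul_tmul, Algebra.TensorProduct.tmul_mul_tmul,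
        Algebra.TensorProduct.tmul_mul_tmul, mul_one, mul_one, map_sub, diagEvl_tmul,
        diagEvl_tmul, tensEvl_tensP, mul_sub, mul_one, map_sub, pcwEvl_mul_pH, mul_assoc,
        pH_mul_pH]
      by_cases h : a ≤ c
      · rw [if_pos h, sup_eq_right.2 h]
        simp
      · rw [if_neg h, sup_eq_left.2 (le_of_not_ge h)]
        simp

variable [IsStrictOrderedRing K]

/-- The evaluation at `ξ = c` on the bivariate distribution module. -/
def biEvl (c : K) : DistBi K F →ₗ[K] Dist K F :=
  DistBi.lift K F (tensEvl K F c) (diagEvl K F c) (diagEvl_rel K F c)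

/-- The shifted Rota-Baxter operator `∫_c^ξ = (1 - e_c) ∫^ξ`. -/
def biIntFrom (c : K) : DistBi K F →ₗ[K] DistBi K F :=
  (LinearMap.id - distX K F ∘ₗ biEvl K F c) ∘ₗ biInt K F

/-- The definite integral `∫_α^β = ∫_α^ξ - ∫_β^ξ`. -/
def biDefInt (α β : K) : DistBi K F →ₗ[K] DistBi K F := biIntFrom K F α - biIntFrom K F β

/-! ## The ring of integro-differential operators -/

/-- The generators of the operator ring: the elements of `F`, the derivation, the integral, and
the evaluations `e_a` for `a ∈ K`. -/
inductive OpGen : Type (max u v)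
  | fn : F → OpGen
  | der : OpGen
  | int : OpGen
  | ev : K → OpGen

section Relations

variable {F}

/-- The element `f ∈ F` in the free algebra. -/
def gFn (f : F) : FreeAlgebra K (OpGen K F) := FreeAlgebra.ι K (OpGen.fn f)

variable (F)

/-- The generator `∂` in the free algebra. -/
def gDer : FreeAlgebra K (OpGen K F) := FreeAlgebra.ι K OpGen.der

/-- The generator `∫` in the free algebra. -/
def gInt : FreeAlgebra K (OpGen K F) := FreeAlgebra.ι K OpGen.int

variable {K} in
/-- The generator `e_a` in the free algebra. -/
def gEv (a : K) : FreeAlgebra K (OpGen K F) := FreeAlgebra.ι K (OpGen.ev a)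

/-- The defining relations of the operator ring. -/
inductive OpRel : FreeAlgebra K (OpGen K F) → FreeAlgebra K (OpGen K F) → Prop
  | fn_add (f g : F) : OpRel (gFn K (f + g)) (gFn K f + gFn K g)
  | fn_smul (c : K) (f : F) : OpRel (gFn K (c • f)) (c • gFn K f)
  | fn_one : OpRel (gFn K 1) 1
  | fn_mul (f g : F) : OpRel (gFn K (f * g)) (gFn K f * gFn K g)
  | ev_ev (a b : K) : OpRel (gEv F a * gEv F b) (gEv F b)
  | ev_fn (a : K) (f : F) : OpRel (gEv F a * gFn K f) (evlAt K a f • gEv F a)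
  | der_fn (f : F) : OpRel (gDer K F * gFn K f) (gFn K f * gDer K F + gFn K (dd K f))
  | der_ev (a : K) : OpRel (gDer K F * gEv F a) 0
  | der_int : OpRel (gDer K F * gInt K F) 1
  | int_fn_int (f : F) : OpRel (gInt K F * gFn K f * gInt K F)
      (gFn K (ii K f) * gInt K F - gInt K F * gFn K (ii K f))
  | int_fn_der (f : F) : OpRel (gInt K F * gFn K f * gDer K F)
      (gFn K f - gInt K F * gFn K (dd K f) - evl K f • gEv F 0)
  | int_fn_ev (f : F) (a : K) : OpRel (gInt K F * gFn K f * gEv F a) (gFn K (ii K f) * gEv F a)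

end Relations

/-- The ring `F_Φ[∂,∫]` of integro-differential operators for `Φ = {e_a | a ∈ K}`. -/
abbrev OpRing : Type (max u v) := RingQuot (OpRel K F)

variable {F} in
/-- The multiplication operator `f`. -/
def oFn (f : F) : OpRing K F := RingQuot.mkAlgHom K (OpRel K F) (gFn K f)

/-- The operator `∂`. -/
def oDer : OpRing K F := RingQuot.mkAlgHom K (OpRel K F) (gDer K F)

/-- The operator `∫`. -/
def oInt : OpRing K F := RingQuot.mkAlgHom K (OpRel K F) (gInt K F)

variable {K} in
/-- The operator `e_a`. -/
def oEv (a : K) : OpRing K F := RingQuot.mkAlgHom K (OpRel K F) (gEv F a)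

theorem cst_apply (a : K) (f : F) : cst K a f = algebraMap K F (evlAt K a f) := rfl

theorem ii_dd (f : F) : ii K (dd K f) = f - cst K (0 : K) f := by
  rw [cst_apply, evlAt_zero, algebraMap_evl]; ring

theorem cst_zero_eq (f : F) : cst K (0 : K) f = algebraMap K F (evl K f) := by
  rw [cst_apply, evlAt_zero]

theorem cst_cst (a b : K) (f : F) : cst K a (cst K b f) = cst K b f := by
  rw [cst_apply, cst_apply, AlgHom.commutes]; rfl

theorem dd_cst (a : K) (f : F) : dd K (cst K a f) = 0 := by rw [cst_apply, dd_algebraMap]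

theorem cst_mul_eq_smul (a : K) (f g : F) : cst K a f * g = evlAt K a f • g := by
  rw [cst_apply, Algebra.smul_def]

theorem ii_cst_mul (a : K) (f g : F) : ii K (cst K a f * g) = cst K a f * ii K g := by
  rw [cst_mul_eq_smul, map_smul, cst_mul_eq_smul]

theorem evlAt_zero_ii (f : F) : evlAt K (0 : K) (ii K f) = 0 := by
  refine OrdinaryIDAlgebra.algebraMap_injective (K := K) (F := F) ?_
  rw [evlAt_zero, algebraMap_evl, dd_ii, sub_self, map_zero]

/-- The Rota-Baxter identity. -/
theorem ii_mul_ii (f g : F) : ii K f * ii K g = ii K (ii K f * g) + ii K (f * ii K g) := by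
  have h : ii K f * ii K g = ii K (ii K f * g) + ii K (dd K (ii K f) * ii K g) :=
    OrdinaryIDAlgebra.strong_rotaBaxter (K := K) (ii K f) g
  rwa [dd_ii] at h

theorem ii_mul_dd (f u : F) : ii K (f * dd K u) =
    f * u - ii K (dd K f * u) - cst K (0 : K) f * cst K (0 : K) u := by
  have h := ii_dd K F (f * u)
  rw [dd_mul, map_add, map_mul (cst K (0 : K))] at h
  linear_combination h

/-- The values of the action of the operator ring on `F` on generators. -/
def actGen : OpGen K F → Module.End K F
  | .fn f => LinearMap.mulLeft K f
  | .der => dd K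
  | .int => ii K
  | .ev a => (cst K a).toLinearMap

theorem actGen_rel {x y : FreeAlgebra K (OpGen K F)} (h : OpRel K F x y) :
    FreeAlgebra.lift K (actGen K F) x = FreeAlgebra.lift K (actGen K F) y := by
  have hf : ∀ f : F, FreeAlgebra.lift K (actGen K F) (gFn K f) = LinearMap.mulLeft K f :=
    fun f => FreeAlgebra.lift_ι_apply _ _
  have hd : FreeAlgebra.lift K (actGen K F) (gDer K F) = dd K := FreeAlgebra.lift_ι_apply _ _
  have hi : FreeAlgebra.lift K (actGen K F) (gInt K F) = ii K := FreeAlgebra.lift_ι_apply _ _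
  have he : ∀ a : K, FreeAlgebra.lift K (actGen K F) (gEv F a) = (cst K a).toLinearMap :=
    fun a => FreeAlgebra.lift_ι_apply _ _
  cases h <;> simp only [map_mul, map_add, map_sub, map_smul, map_one, map_zero, hf, hd, hi, he] <;>
    refine LinearMap.ext fun g => ?_
  case fn_add f f' => simp [add_mul]
  case fn_smul c f => simp
  case fn_one => simp
  case fn_mul f f' => simp
  case ev_ev a b => simp [cst_cst]
  case ev_fn a f => simp [cst_mul_eq_smul]
  case der_fn f => simp [dd_mul]
  case der_ev a => simp [dd_cst]
  case der_int => simp [dd_ii]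
  case int_fn_int f =>
    have := ii_mul_ii K F f g
    simp only [Module.End.mul_apply, LinearMap.sub_apply, LinearMap.mulLeft_apply]
    rw [this]; ring
  case int_fn_der f =>
    simp only [Module.End.mul_apply, LinearMap.sub_apply, LinearMap.mulLeft_apply,
      LinearMap.smul_apply, AlgHom.toLinearMap_apply]
    rw [ii_mul_dd, cst_mul_eq_smul, evlAt_zero]
  case int_fn_ev f a =>
    simp only [Module.End.mul_apply, LinearMap.mulLeft_apply, AlgHom.toLinearMap_apply]
    rw [mul_comm, ii_cst_mul, mul_comm]

/-- The natural action of the operator ring on `F`. -/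
def act : OpRing K F →ₐ[K] Module.End K F :=
  RingQuot.liftAlgHom K ⟨FreeAlgebra.lift K (actGen K F), fun _ _ h => actGen_rel K F h⟩

/-! ## Normal forms -/

/-- The space of normal forms: a linear combination of the elements `u ∂^i` (index `(none, i)`),
`u e_a ∂^i` (index `(some a, i)`), `u ∫ v` (index `none`) and `u e_a ∫ v` (index `some a`). -/
abbrev OpNF : Type (max u v) := (Option K × ℕ →₀ F) × (Option K →₀ F ⊗[K] F)

variable {K} in
/-- The normal forms `u ∂^i` and `u e_a ∂^i`. -/
def nfLoc (o : Option K) (i : ℕ) : F →ₗ[K] OpNF K F := LinearMap.inl K _ _ ∘ₗ Finsupp.lsingle (o, i)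

variable {K} in
/-- The normal forms `u ∫ v` and `u e_a ∫ v`. -/
def nfGlo (o : Option K) : F ⊗[K] F →ₗ[K] OpNF K F := LinearMap.inr K _ _ ∘ₗ Finsupp.lsingle o

/-- Linear maps on the space of normal forms. -/
def nfLift {M : Type*} [AddCommGroup M] [Module K M] (φ : Option K → ℕ → (F →ₗ[K] M))
    (ψ : Option K → (F ⊗[K] F →ₗ[K] M)) : OpNF K F →ₗ[K] M :=
  (Finsupp.lsum K fun p : Option K × ℕ => φ p.1 p.2).coprod (Finsupp.lsum K ψ)

theorem nfLift_loc {M : Type*} [AddCommGroup M] [Module K M] (φ : Option K → ℕ → (F →ₗ[K] M))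
    (ψ : Option K → (F ⊗[K] F →ₗ[K] M)) (o : Option K) (i : ℕ) (u : F) :
    nfLift K F φ ψ (nfLoc F o i u) = φ o i u := by
  simp [nfLift, nfLoc]

theorem nfLift_glo {M : Type*} [AddCommGroup M] [Module K M] (φ : Option K → ℕ → (F →ₗ[K] M))
    (ψ : Option K → (F ⊗[K] F →ₗ[K] M)) (o : Option K) (t : F ⊗[K] F) :
    nfLift K F φ ψ (nfGlo F o t) = ψ o t := by
  simp [nfLift, nfGlo]

theorem nf_hom_ext {M : Type*} [AddCommGroup M] [Module K M] {φ ψ : OpNF K F →ₗ[K] M}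
    (h1 : ∀ o i u, φ (nfLoc F o i u) = ψ (nfLoc F o i u))
    (h2 : ∀ o u v, φ (nfGlo F o (u ⊗ₜ[K] v)) = ψ (nfGlo F o (u ⊗ₜ[K] v))) : φ = ψ := by
  refine LinearMap.prod_ext ?_ ?_
  · refine Finsupp.lhom_ext fun p u => ?_
    exact h1 p.1 p.2 u
  · refine Finsupp.lhom_ext fun o t => ?_
    change (φ ∘ₗ nfGlo F o) t = (ψ ∘ₗ nfGlo F o) t
    congr 1
    exact TensorProduct.ext' fun u v => h2 o u v

/-- Left multiplication by `f` on normal forms. -/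
def nfFn (f : F) : Module.End K (OpNF K F) :=
  nfLift K F (fun o i => nfLoc F o i ∘ₗ LinearMap.mulLeft K f)
    (fun o => nfGlo F o ∘ₗ LinearMap.rTensor F (LinearMap.mulLeft K f))

/-- Left multiplication by `∂` on the normal forms `u ∂^i` and `u e_a ∂^i`. -/
def nfDerLoc : Option K → ℕ → (F →ₗ[K] OpNF K F)
  | none, i => nfLoc F none i ∘ₗ dd K + nfLoc F none (i + 1)
  | some a, i => nfLoc F (some a) i ∘ₗ dd K

/-- Left multiplication by `∂` on the normal forms `u ∫ v` and `u e_a ∫ v`. -/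
def nfDerGlo : Option K → (F ⊗[K] F →ₗ[K] OpNF K F)
  | none => nfGlo F none ∘ₗ LinearMap.rTensor F (dd K) + nfLoc F none 0 ∘ₗ LinearMap.mul' K F
  | some a => nfGlo F (some a) ∘ₗ LinearMap.rTensor F (dd K)

/-- Left multiplication by `∂` on normal forms. -/
def nfDer : Module.End K (OpNF K F) := nfLift K F (nfDerLoc K F) (nfDerGlo K F)

/-- Left multiplication by `∫` on the normal forms `u ∂^i`:
`∫ u ∂^(i+1) = u ∂^i - ∫ u' ∂^i - u(0) e_0 ∂^i`. -/
def nfIntDer : ℕ → (F →ₗ[K] OpNF K F)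
  | 0 => nfGlo F none ∘ₗ TensorProduct.mk K F F 1
  | i + 1 => nfLoc F none i - nfIntDer i ∘ₗ dd K - nfLoc F (some 0) i ∘ₗ (cst K (0 : K)).toLinearMap

/-- Left multiplication by `∫` on the normal forms `u ∂^i` and `u e_a ∂^i`. -/
def nfIntLoc : Option K → ℕ → (F →ₗ[K] OpNF K F)
  | none, i => nfIntDer K F i
  | some a, i => nfLoc F (some a) i ∘ₗ ii K

/-- Left multiplication by `∫` on the normal forms `u ∫ v` and `u e_a ∫ v`. -/
def nfIntGlo : Option K → (F ⊗[K] F →ₗ[K] OpNF K F)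
  | none => nfGlo F none ∘ₗ (LinearMap.rTensor F (ii K) -
      TensorProduct.mk K F F 1 ∘ₗ LinearMap.mul' K F ∘ₗ LinearMap.rTensor F (ii K))
  | some a => nfGlo F (some a) ∘ₗ LinearMap.rTensor F (ii K)

/-- Left multiplication by `∫` on normal forms. -/
def nfInt : Module.End K (OpNF K F) := nfLift K F (nfIntLoc K F) (nfIntGlo K F)

variable {K} in
/-- Left multiplication by `e_b` on the normal forms `u ∫ v` and `u e_a ∫ v`, where
`e_0 u ∫ v = 0`. -/
def nfEvGlo (b : K) : Option K → (F ⊗[K] F →ₗ[K] OpNF K F)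
  | none => if b = 0 then 0 else nfGlo F (some b) ∘ₗ LinearMap.rTensor F (cst K b).toLinearMap
  | some a => nfGlo F (some a) ∘ₗ LinearMap.rTensor F (cst K b).toLinearMap

variable {K} in
/-- Left multiplication by `e_b` on normal forms. -/
def nfEv (b : K) : Module.End K (OpNF K F) :=
  nfLift K F (fun o i => nfLoc F (some (o.getD b)) i ∘ₗ (cst K b).toLinearMap) (nfEvGlo F b)

theorem nfFn_loc (f : F) (o : Option K) (i : ℕ) (u : F) :
    nfFn K F f (nfLoc F o i u) = nfLoc F o i (f * u) := by
  rw [nfFn, nfLift_loc]; rfl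

theorem nfFn_glo (f : F) (o : Option K) (u v : F) :
    nfFn K F f (nfGlo F o (u ⊗ₜ[K] v)) = nfGlo F o ((f * u) ⊗ₜ[K] v) := by
  rw [nfFn, nfLift_glo]; rfl

theorem nfDer_loc_none (i : ℕ) (u : F) : nfDer K F (nfLoc F none i u) =
    nfLoc F none i (dd K u) + nfLoc F none (i + 1) u := by
  rw [nfDer, nfLift_loc]; rfl

theorem nfDer_loc_some (a : K) (i : ℕ) (u : F) : nfDer K F (nfLoc F (some a) i u) =
    nfLoc F (some a) i (dd K u) := by
  rw [nfDer, nfLift_loc]; rfl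

theorem nfDer_glo_none (u v : F) : nfDer K F (nfGlo F none (u ⊗ₜ[K] v)) =
    nfGlo F none (dd K u ⊗ₜ[K] v) + nfLoc F none 0 (u * v) := by
  rw [nfDer, nfLift_glo]; rfl

theorem nfDer_glo_some (a : K) (u v : F) : nfDer K F (nfGlo F (some a) (u ⊗ₜ[K] v)) =
    nfGlo F (some a) (dd K u ⊗ₜ[K] v) := by
  rw [nfDer, nfLift_glo]; rfl

theorem nfInt_loc_zero (u : F) : nfInt K F (nfLoc F none 0 u) = nfGlo F none (1 ⊗ₜ[K] u) := by
  rw [nfInt, nfLift_loc]; rfl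

theorem nfInt_loc_succ (i : ℕ) (u : F) : nfInt K F (nfLoc F none (i + 1) u) =
    nfLoc F none i u - nfInt K F (nfLoc F none i (dd K u)) -
      nfLoc F (some 0) i (cst K (0 : K) u) := by
  rw [nfInt, nfLift_loc, nfLift_loc]; rfl

theorem nfInt_loc_some (a : K) (i : ℕ) (u : F) : nfInt K F (nfLoc F (some a) i u) =
    nfLoc F (some a) i (ii K u) := by
  rw [nfInt, nfLift_loc]; rfl

theorem nfInt_glo_none (u v : F) : nfInt K F (nfGlo F none (u ⊗ₜ[K] v)) =
    nfGlo F none (ii K u ⊗ₜ[K] v - 1 ⊗ₜ[K] (ii K u * v)) := by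
  rw [nfInt, nfLift_glo]; rfl

theorem nfInt_glo_some (a : K) (u v : F) : nfInt K F (nfGlo F (some a) (u ⊗ₜ[K] v)) =
    nfGlo F (some a) (ii K u ⊗ₜ[K] v) := by
  rw [nfInt, nfLift_glo]; rfl

theorem nfEv_loc_none (b : K) (i : ℕ) (u : F) : nfEv F b (nfLoc F none i u) =
    nfLoc F (some b) i (cst K b u) := by
  rw [nfEv, nfLift_loc]; rfl

theorem nfEv_loc_some (b a : K) (i : ℕ) (u : F) : nfEv F b (nfLoc F (some a) i u) =
    nfLoc F (some a) i (cst K b u) := by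
  rw [nfEv, nfLift_loc]; rfl

theorem nfEv_glo_none (b : K) (u v : F) : nfEv F b (nfGlo F none (u ⊗ₜ[K] v)) =
    if b = 0 then 0 else nfGlo F (some b) (cst K b u ⊗ₜ[K] v) := by
  rw [nfEv, nfLift_glo, nfEvGlo]; split_ifs <;> rfl

theorem nfEv_glo_some (b a : K) (u v : F) : nfEv F b (nfGlo F (some a) (u ⊗ₜ[K] v)) =
    nfGlo F (some a) (cst K b u ⊗ₜ[K] v) := by
  rw [nfEv, nfLift_glo]; rfl

theorem cst_smul_map {M : Type*} [AddCommGroup M] [Module K M] (φ : F →ₗ[K] M) (a : K) (f g : F) :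
    φ (cst K a f * g) = evlAt K a f • φ g := by
  rw [cst_mul_eq_smul, map_smul]

theorem cst_mul_tmul (a : K) (f u v : F) :
    (cst K a f * u) ⊗ₜ[K] v = evlAt K a f • (u ⊗ₜ[K] v) := by
  rw [cst_mul_eq_smul, TensorProduct.smul_tmul']

theorem tmul_cst_mul (a : K) (f u v : F) :
    u ⊗ₜ[K] (cst K a f * v) = evlAt K a f • (u ⊗ₜ[K] v) := by
  rw [cst_mul_eq_smul, TensorProduct.tmul_smul]

theorem nfInt_fn_int_loc (f : F) (i : ℕ) : ∀ u : F,
    nfInt K F (nfFn K F f (nfInt K F (nfLoc F none i u))) =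
      nfFn K F (ii K f) (nfInt K F (nfLoc F none i u)) -
        nfInt K F (nfFn K F (ii K f) (nfLoc F none i u)) := by
  induction i with
  | zero =>
    intro u
    rw [nfInt_loc_zero, nfFn_glo, nfFn_glo, nfInt_glo_none, nfFn_loc, nfInt_loc_zero, mul_one,
      mul_one, map_sub]
  | succ i ih =>
    intro u
    rw [nfInt_loc_succ]
    simp only [map_sub, ih, nfFn_loc, nfInt_loc_succ, nfInt_loc_some, dd_mul, dd_ii, map_add,
      map_mul]
    have h0 : cst K (0 : K) (ii K f) = 0 := by rw [cst_apply, evlAt_zero_ii, map_zero]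
    rw [h0, zero_mul, map_zero, mul_comm f (cst K (0 : K) u), ii_cst_mul,
      mul_comm (cst K (0 : K) u)]
    abel

/-- The values of the left regular representation on generators. -/
def nfGen : OpGen K F → Module.End K (OpNF K F)
  | .fn f => nfFn K F f
  | .der => nfDer K F
  | .int => nfInt K F
  | .ev a => nfEv F a

theorem nfGen_rel {x y : FreeAlgebra K (OpGen K F)} (h : OpRel K F x y) :
    FreeAlgebra.lift K (nfGen K F) x = FreeAlgebra.lift K (nfGen K F) y := by
  have hf : ∀ f : F, FreeAlgebra.lift K (nfGen K F) (gFn K f) = nfFn K F f :=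
    fun f => FreeAlgebra.lift_ι_apply _ _
  have hd : FreeAlgebra.lift K (nfGen K F) (gDer K F) = nfDer K F := FreeAlgebra.lift_ι_apply _ _
  have hi : FreeAlgebra.lift K (nfGen K F) (gInt K F) = nfInt K F := FreeAlgebra.lift_ι_apply _ _
  have he : ∀ a : K, FreeAlgebra.lift K (nfGen K F) (gEv F a) = nfEv F a :=
    fun a => FreeAlgebra.lift_ι_apply _ _
  cases h <;> simp only [map_mul, map_add, map_sub, map_smul, map_one, map_zero, hf, hd, hi, he] <;>
    refine nf_hom_ext K F (fun o i u => ?_) (fun o u v => ?_) <;>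
    simp only [Module.End.mul_apply, Module.End.one_apply, LinearMap.add_apply,
      LinearMap.sub_apply, LinearMap.smul_apply, LinearMap.zero_apply]
  case fn_add.refine_1 f f' => simp only [nfFn_loc, add_mul, map_add]
  case fn_add.refine_2 f f' => simp only [nfFn_glo, add_mul, map_add, TensorProduct.add_tmul]
  case fn_smul.refine_1 c f => simp only [nfFn_loc, smul_mul_assoc, map_smul]
  case fn_smul.refine_2 c f =>
    simp only [nfFn_glo, smul_mul_assoc, map_smul, ← TensorProduct.smul_tmul']
  case fn_one.refine_1 => simp only [nfFn_loc, one_mul]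
  case fn_one.refine_2 => simp only [nfFn_glo, one_mul]
  case fn_mul.refine_1 f f' => simp only [nfFn_loc, mul_assoc]
  case fn_mul.refine_2 f f' => simp only [nfFn_glo, mul_assoc]
  case ev_ev.refine_1 a b =>
    cases o <;> simp only [nfEv_loc_none, nfEv_loc_some, cst_cst]
  case ev_ev.refine_2 a b =>
    cases o with
    | none =>
      rw [nfEv_glo_none]
      split_ifs
      · rw [map_zero]
      · rw [nfEv_glo_some, cst_cst]
    | some c => simp only [nfEv_glo_some, cst_cst]
  case ev_fn.refine_1 a f =>
    cases o <;> simp only [nfFn_loc, nfEv_loc_none, nfEv_loc_some, map_mul, cst_smul_map]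
  case ev_fn.refine_2 a f =>
    cases o with
    | none =>
      rw [nfFn_glo, nfEv_glo_none, nfEv_glo_none]
      split_ifs
      · rw [smul_zero]
      · rw [map_mul, cst_mul_tmul, map_smul]
    | some c => rw [nfFn_glo, nfEv_glo_some, nfEv_glo_some, map_mul, cst_mul_tmul, map_smul]
  case der_fn.refine_1 f =>
    cases o with
    | none =>
      simp only [nfFn_loc, nfDer_loc_none, dd_mul, map_add]
      abel
    | some a => simp only [nfFn_loc, nfDer_loc_some, dd_mul, map_add]
  case der_fn.refine_2 f =>
    cases o with
    | none =>
      simp only [nfFn_glo, nfDer_glo_none, dd_mul, map_add, TensorProduct.add_tmul, nfFn_loc,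
        mul_assoc]
      abel
    | some a => simp only [nfFn_glo, nfDer_glo_some, dd_mul, map_add, TensorProduct.add_tmul]
  case der_ev.refine_1 a =>
    cases o <;> simp only [nfEv_loc_none, nfEv_loc_some, nfDer_loc_some, dd_cst, map_zero]
  case der_ev.refine_2 a =>
    cases o with
    | none =>
      rw [nfEv_glo_none]
      split_ifs
      · rw [map_zero]
      · rw [nfDer_glo_some, dd_cst, TensorProduct.zero_tmul, map_zero]
    | some c => rw [nfEv_glo_some, nfDer_glo_some, dd_cst, TensorProduct.zero_tmul, map_zero]
  case der_int.refine_1 =>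
    cases o with
    | none =>
      induction i generalizing u with
      | zero =>
        have h1 : dd K (1 : F) = 0 := by rw [← map_one (algebraMap K F), dd_algebraMap]
        rw [nfInt_loc_zero, nfDer_glo_none, h1, TensorProduct.zero_tmul, map_zero, zero_add,
          one_mul]
      | succ i ih =>
        rw [nfInt_loc_succ, map_sub, map_sub, ih, nfDer_loc_none, nfDer_loc_some, dd_cst, map_zero]
        abel
    | some a => rw [nfInt_loc_some, nfDer_loc_some, dd_ii]
  case der_int.refine_2 =>
    cases o with
    | none =>
      have h1 : dd K (1 : F) = 0 := by rw [← map_one (algebraMap K F), dd_algebraMap]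
      rw [nfInt_glo_none, map_sub, map_sub, nfDer_glo_none, nfDer_glo_none, h1, dd_ii,
        TensorProduct.zero_tmul, map_zero, one_mul]
      abel
    | some a => rw [nfInt_glo_some, nfDer_glo_some, dd_ii]
  case int_fn_int.refine_1 f =>
    cases o with
    | none => exact nfInt_fn_int_loc K F f i u
    | some a =>
      simp only [nfInt_loc_some, nfFn_loc]
      rw [ii_mul_ii, map_add]
      abel
  case int_fn_int.refine_2 f =>
    cases o with
    | none =>
      simp only [nfInt_glo_none, map_sub, nfFn_glo, mul_one]
      have h := ii_mul_ii K F f u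
      have h2 : ii K f * (ii K u * v) = ii K (ii K f * u) * v + ii K (f * ii K u) * v := by
        rw [← mul_assoc, h, add_mul]
      rw [h2, h, TensorProduct.add_tmul, TensorProduct.tmul_add, map_add, map_add]
      abel
    | some a =>
      simp only [nfInt_glo_some, nfFn_glo]
      rw [ii_mul_ii, TensorProduct.add_tmul, map_add]
      abel
  case int_fn_der.refine_1 f =>
    cases o with
    | none =>
      rw [nfDer_loc_none, map_add, map_add, nfFn_loc, nfFn_loc, nfInt_loc_succ, nfFn_loc,
        nfFn_loc, nfEv_loc_none, dd_mul, map_add, map_add, map_mul (cst K (0 : K)), cst_smul_map,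
        evlAt_zero]
      abel
    | some a =>
      rw [nfDer_loc_some, nfFn_loc, nfInt_loc_some, nfFn_loc, nfFn_loc, nfInt_loc_some,
        nfEv_loc_some, ii_mul_dd, map_sub, map_sub, cst_smul_map, evlAt_zero]
  case int_fn_der.refine_2 f =>
    cases o with
    | none =>
      rw [nfDer_glo_none, map_add, map_add, nfFn_glo, nfFn_loc, nfInt_loc_zero, nfInt_glo_none,
        nfFn_glo, nfFn_glo, nfInt_glo_none, nfEv_glo_none, if_pos rfl, smul_zero, sub_zero, ii_mul_dd]
      have h3 : (f * u - ii K (dd K f * u) - cst K (0 : K) f * cst K (0 : K) u) * v =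
          f * (u * v) - ii K (dd K f * u) * v - cst K (0 : K) f * (cst K (0 : K) u * v) := by
        ring
      have h4 : cst K (0 : K) u ⊗ₜ[K] v = evlAt K (0 : K) u • ((1 : F) ⊗ₜ[K] v) := by
        rw [← cst_mul_tmul, mul_one]
      rw [h3]
      simp only [TensorProduct.sub_tmul, TensorProduct.tmul_sub, cst_mul_tmul, tmul_cst_mul, h4,
        map_sub]
      abel
    | some a =>
      rw [nfDer_glo_some, nfFn_glo, nfInt_glo_some, nfFn_glo, nfFn_glo, nfInt_glo_some,
        nfEv_glo_some, ii_mul_dd, TensorProduct.sub_tmul, TensorProduct.sub_tmul, cst_mul_tmul, map_sub,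
        map_sub, map_smul, evlAt_zero]
  case int_fn_ev.refine_1 f a =>
    cases o <;> simp only [nfEv_loc_none, nfEv_loc_some, nfFn_loc, nfInt_loc_some] <;>
      rw [mul_comm, ii_cst_mul, mul_comm]
  case int_fn_ev.refine_2 f a =>
    cases o with
    | none =>
      rw [nfEv_glo_none]
      split_ifs
      · simp only [map_zero]
      · rw [nfFn_glo, nfFn_glo, nfInt_glo_some, mul_comm, ii_cst_mul, mul_comm]
    | some c => rw [nfEv_glo_some, nfFn_glo, nfFn_glo, nfInt_glo_some, mul_comm, ii_cst_mul, mul_comm]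

/-- The left regular representation of the operator ring on the space of normal forms. -/
def nfRep : OpRing K F →ₐ[K] Module.End K (OpNF K F) :=
  RingQuot.liftAlgHom K ⟨FreeAlgebra.lift K (nfGen K F), fun _ _ h => nfGen_rel K F h⟩

/-- The normal form of an integro-differential operator. -/
def nf : OpRing K F →ₗ[K] OpNF K F :=
  LinearMap.applyₗ (nfLoc F none 0 1) ∘ₗ (nfRep K F).toLinearMap

/-! ## The extraction map -/

theorem DistBi.hom_ext {M : Type*} [AddCommGroup M] [Module K M] {φ ψ : DistBi K F →ₗ[K] M}
    (h1 : ∀ ω p, φ (biT K F (tensL K F (ω ⊗ₜ[K] p))) = ψ (biT K F (tensL K F (ω ⊗ₜ[K] p))))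
    (h2 : ∀ p ω, φ (biT K F (tensR K F (p ⊗ₜ[K] ω))) = ψ (biT K F (tensR K F (p ⊗ₜ[K] ω))))
    (h3 : ∀ n p q, φ (biD K F n (p ⊗ₜ[K] q)) = ψ (biD K F n (p ⊗ₜ[K] q))) : φ = ψ := by
  refine Submodule.linearMap_qext _ (LinearMap.prod_ext ?_ ?_)
  · refine Submodule.linearMap_qext _ (LinearMap.prod_ext ?_ ?_)
    · exact TensorProduct.ext' h1
    · exact TensorProduct.ext' h2
  · refine TensorProduct.ext (LinearMap.ext fun p => Finsupp.lhom_ext fun n c => ?_)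
    have h (θ : DistBi K F →ₗ[K] M) : ((TensorProduct.mk K (PcwBi K F) (SlimDist K)).compr₂
        ((θ ∘ₗ (diagRel K F).mkQ) ∘ₗ LinearMap.inr K _ _)) p (Finsupp.single n c) =
          c • θ (biD K F n p) := by
      rw [← mul_one c, ← smul_eq_mul, ← Finsupp.smul_single, map_smul, smul_eq_mul, mul_one]
      rfl
    refine (h φ).trans (Eq.trans ?_ (h ψ).symm)
    congr 1
    change (φ ∘ₗ biD K F n) p = (ψ ∘ₗ biD K F n) p
    congr 1
    exact TensorProduct.ext' (h3 n)

theorem biMul_tensL (u v : F) (ω : Dist K F) (p : Pcw K F) :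
    biMul K F u v (biT K F (tensL K F (ω ⊗ₜ[K] p))) =
      biT K F (tensL K F ((u • ω) ⊗ₜ[K] (v • p))) := by
  rw [biMul, DistBi.lift_biT, LinearMap.comp_apply, tensMul, TensDist.lift_tensL]
  rfl

theorem biMul_tensR (u v : F) (p : Pcw K F) (ω : Dist K F) :
    biMul K F u v (biT K F (tensR K F (p ⊗ₜ[K] ω))) =
      biT K F (tensR K F ((u • p) ⊗ₜ[K] (v • ω))) := by
  rw [biMul, DistBi.lift_biT, LinearMap.comp_apply, tensMul, TensDist.lift_tensR]
  rfl

theorem biMul_biD (u v : F) (n : ℕ) (p q : Pcw K F) :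
    biMul K F u v (biD K F n (p ⊗ₜ[K] q)) = biD K F n ((u • p) ⊗ₜ[K] (v • q)) := by
  rw [biMul, DistBi.lift_biD]
  rfl

/-- The bilinear map `(u, v) ↦ u(x) v(ξ) g` for `g ∈ D_2`. -/
def biMulMap (g : DistBi K F) : F →ₗ[K] F →ₗ[K] DistBi K F :=
  LinearMap.mk₂ K (fun u v => biMul K F u v g)
    (fun u u' v => by
      rw [← LinearMap.add_apply]
      congr 1
      refine DistBi.hom_ext K F ?_ ?_ ?_ <;> intros <;>
        simp only [LinearMap.add_apply, biMul_tensL, biMul_tensR, biMul_biD, add_smul,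
          TensorProduct.add_tmul, map_add])
    (fun c u v => by
      rw [← LinearMap.smul_apply]
      congr 1
      refine DistBi.hom_ext K F ?_ ?_ ?_ <;> intros <;>
        simp only [LinearMap.smul_apply, biMul_tensL, biMul_tensR, biMul_biD, smul_assoc,
          ← TensorProduct.smul_tmul', map_smul])
    (fun u v v' => by
      rw [← LinearMap.add_apply]
      congr 1
      refine DistBi.hom_ext K F ?_ ?_ ?_ <;> intros <;>
        simp only [LinearMap.add_apply, biMul_tensL, biMul_tensR, biMul_biD, add_smul,
          TensorProduct.tmul_add, map_add])
    (fun c u v => by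
      rw [← LinearMap.smul_apply]
      congr 1
      refine DistBi.hom_ext K F ?_ ?_ ?_ <;> intros <;>
        simp only [LinearMap.smul_apply, biMul_tensL, biMul_tensR, biMul_biD, smul_assoc,
          TensorProduct.tmul_smul, map_smul])

/-- The constant function `1` in `D_2`. -/
def biOne : DistBi K F := biT K F (tensP K F 1)

variable {K} in
/-- The kernels `δ^(i)(x-ξ)` and `(-1)^i δ^(i)(ξ-a)` that belong to `∂^i` and `e_a ∂^i`. -/
def kerLoc : Option K → ℕ → DistBi K F
  | none, i => biD K F (i + 1) 1
  | some a, i => (-1 : K) ^ i • distXi K F (dH F a (i + 1))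

variable {K} in
/-- The signed characteristic functions `[0 ≤ ξ ≤ x]_± = H(x-ξ) + H(ξ) - 1` and
`[0 ≤ ξ ≤ a]_± = H(ξ) - H(ξ-a)` that belong to `∫` and `e_a ∫`. -/
def kerGlo : Option K → DistBi K F
  | none => biD K F 0 1 + distXi K F (dH F 0 0) - biOne K F
  | some a => distXi K F (dH F 0 0) - distXi K F (dH F a 0)

/-- The extraction map on normal forms:
`u ∂^i ↦ u(x) δ^(i)(x-ξ)`, `u e_a ∂^i ↦ (-1)^i u(x) δ^(i)(ξ-a)`,
`u ∫ v ↦ u(x) v(ξ) [0 ≤ ξ ≤ x]_±` and `u e_a ∫ v ↦ u(x) v(ξ) [0 ≤ ξ ≤ a]_±`. -/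
def extractNF : OpNF K F →ₗ[K] DistBi K F :=
  nfLift K F (fun o i => (biMulMap K F (kerLoc F o i)).flip 1)
    (fun o => TensorProduct.lift (biMulMap K F (kerGlo F o)))

/-- The extraction map `η : F_Φ[∂,∫] → D_2`, `G ↦ G_xξ`. -/
def extract : OpRing K F →ₗ[K] DistBi K F := extractNF K F ∘ₗ nf K F

variable {K F} in
/-- The points `a` such that a term `u e_a ∂^i` occurs in `G`. -/
def localPts (G : OpRing K F) : Set K := {a | ∃ i : ℕ, (nf K F G).1 (some a, i) ≠ 0}

variable {K F} in
/-- The points `a` such that a term `u e_a ∂^i` or `u e_a ∫ v` occurs in `G`. -/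
def evalPts (G : OpRing K F) : Set K := localPts G ∪ {a | (nf K F G).2 (some a) ≠ 0}

variable {K F} in
/-- The equality `u(x) = ∫_α^β g(x,ξ) f(ξ)` on `[α, β]`: the integral is a piecewise function
in `x`, which equals `u(x)` modulo the ideal of `[α, β]`. -/
def EqIntegral (α β : K) (g : DistBi K F) (f u : F) : Prop :=
  ∃ p : Pcw K F, distX K F (pcwToDist K F p) = biDefInt K F α β (biMul K F 1 f g) ∧
    EqOnInterval α β (pC F u) p

/-! ## Boundary problems -/

/-- The Stieltjes conditions: the right ideal generated by the evaluations. -/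
def stieltjesCond : Submodule K (OpRing K F) :=
  Submodule.span K {b | ∃ (a : K) (G : OpRing K F), b = oEv F a * G}

variable {K F} in
/-- The linear functional `ℓ : F → K` is the action of a Stieltjes condition. -/
def IsStieltjes (ℓ : Module.Dual K F) : Prop :=
  ∃ b ∈ stieltjesCond K F, ∀ f : F, act K F b f = algebraMap K F (ℓ f)

/-- A Stieltjes boundary problem: a monic differential operator
`T = ∂^n + c_{n-1} ∂^(n-1) + ... + c_0` and `n` linearly independent Stieltjes conditions. -/
structure BoundaryProblem where
  order : ℕ
  coeff : Fin order → F
  cond : Fin order → Module.Dual K F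
  cond_stieltjes : ∀ i, IsStieltjes (cond i)
  cond_indep : LinearIndependent K cond

namespace BoundaryProblem

variable {K F} (P : BoundaryProblem K F)

/-- The monic differential operator `T`. -/
def op : OpRing K F := oDer K F ^ P.order + ∑ i, oFn K (P.coeff i) * oDer K F ^ (i : ℕ)

/-- The boundary space, spanned by the boundary conditions. -/
def space : Submodule K (Module.Dual K F) := Submodule.span K (Set.range P.cond)

/-- The space of admissible functions: the orthogonal of the boundary space. -/
def admissible : Submodule K F := P.space.dualCoannihilator

/-- Regularity: `F` is the direct sum of the kernel of `T` and the space of admissible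
functions. -/
def IsRegular : Prop := IsCompl (LinearMap.ker (act K F P.op)) P.admissible

/-- `G` is the Green's operator: `T G = 1` and the image of `G` is the space of admissible
functions. -/
def IsGreenOperator (G : OpRing K F) : Prop :=
  (∀ f : F, act K F P.op (act K F G f) = f) ∧ LinearMap.range (act K F G) = P.admissible

/-- `u` is a solution of the boundary problem with forcing function `f`. -/
def IsSolution (f u : F) : Prop := act K F P.op u = f ∧ ∀ i, P.cond i u = 0

/-- `g` is the Green's function on `[α, β]`: for every forcing function `f` the boundary problem has
exactly one solution `u`, and `u(x) = ∫_α^β g(x,ξ) f(ξ)` on `[α, β]`. -/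
def IsGreenFunction (α β : K) (g : DistBi K F) : Prop :=
  ∀ f : F, (∃! u : F, P.IsSolution f u) ∧ ∀ u : F, P.IsSolution f u → EqIntegral α β g f u

end BoundaryProblem

end

end IntDiffDirac

end

noncomputable section

namespace IntDiffDirac

open scoped TensorProduct

variable {K F : Type*} [Field K] [LinearOrder K] [CommRing F] [Algebra K F]
  [OrdinaryShiftedIDAlgebra K F] [IsStrictOrderedRing K]

/-! ## The action of normal forms -/

/-! Both sides of the integral formula are linear in the operator, so it suffices to check the
formula on the four kinds of normal-form terms. The extraction reads off the normal form of G, so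
one first needs that this normal form acts on F exactly as G does (`actNF_nf`). The action
intertwines left multiplication by each generator on normal forms with the action of that generator
on F (`actNF_nfGen`), and the normal form of G is G applied to the normal form of 1.

For a single kernel, the definite integral over [α, β] equals e_β ∫ - e_α ∫ in the variable ξ
(`biDefInt_apply`), so only evaluated antiderivatives matter. Evaluation kills the Dirac terms in ξ
and on the diagonal, which leaves a piecewise function of x. Parts of the antiderivative that do not
depend on the evaluation point cancel. Write Φ = ∫ v f. Integrated against v f and multiplied by
u(x), the kernels H(x-ξ), H_0(ξ), H_a(ξ) and 1 give u times Φ(x) - Φ(α), Φ(β), Φ(β) - Φ(a) and Φ(β)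
- Φ(α). Hence H(x-ξ) + H_0(ξ) - 1 telescopes to u Φ and H_0(ξ) - H_a(ξ) telescopes to u Φ(a), which
are the actions of u ∫ v and u e_a ∫ v. Integrated against f, δ^(i)(x-ξ) gives the i-th derivative
of f at x, and δ^(i)(ξ-a) gives (-1)^i times its value at a, the sign being undone by the
extraction.

Restriction to [α, β] matters only for the diagonal kernels: their integrals carry factors H_α(x)
and H_β(x), which become 1 and 0 modulo the ideal of the interval. Kernels in ξ alone integrate to
an exact constant multiple of u. Since 1 - H(a-c) is the indicator of a ≤ c, a Dirac at a is seen by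
the integral exactly when α < a ≤ β. A Heaviside kernel at a = α is harmless because its
contribution at α is Φ(α) - Φ(a) = 0.

For a boundary problem, T G = 1 and the image condition make G f a solution, regularity makes it the
only one, and the integral formula then represents it. -/

variable (K F) in
/-- The identity (index `none`) and the evaluations (index `some a`), as operators on `F`. -/
def evalOp : Option K → Module.End K F
  | none => 1
  | some a => (cst K a).toLinearMap

variable (K F) in
/-- The action of normal forms on `F`. -/
def actNF : OpNF K F →ₗ[K] Module.End K F :=
  nfLift K F (fun o i => LinearMap.mulRight K (evalOp K F o * dd K ^ i) ∘ₗ LinearMap.mul K F)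
    (fun o => TensorProduct.lift ((LinearMap.mul K (Module.End K F)).compl₁₂ (LinearMap.mul K F)
      (LinearMap.mulLeft K (evalOp K F o * ii K) ∘ₗ LinearMap.mul K F)))

theorem actNF_loc (o : Option K) (i : ℕ) (u f : F) :
    actNF K F (nfLoc F o i u) f = u * evalOp K F o ((dd K)^[i] f) := by
  rw [actNF, nfLift_loc, ← Module.End.coe_pow]; rfl

theorem actNF_glo (o : Option K) (u v f : F) :
    actNF K F (nfGlo F o (u ⊗ₜ[K] v)) f = u * evalOp K F o (ii K (v * f)) := by
  rw [actNF, nfLift_glo]; rfl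

theorem dd_evalOp_some (a : K) (f : F) : dd K (evalOp K F (some a) f) = 0 := dd_cst K F a f

theorem ii_mul_evalOp_some (a : K) (u f : F) :
    ii K (u * evalOp K F (some a) f) = ii K u * evalOp K F (some a) f := by
  change ii K (u * cst K a f) = ii K u * cst K a f
  rw [mul_comm, ii_cst_mul, mul_comm]

theorem cst_evalOp_some (b a : K) (f : F) :
    cst K b (evalOp K F (some a) f) = evalOp K F (some a) f := cst_cst K F b a f

theorem evlAt_cst (b a : K) (f : F) : evlAt K b (cst K a f) = evlAt K a f := by
  rw [cst_apply, AlgHom.commutes]; rfl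

theorem cst_zero_ii (f : F) : cst K (0 : K) (ii K f) = 0 := by
  rw [cst_apply, evlAt_zero_ii, map_zero]

/-- Left multiplication of u ∂^i by ∫ is defined by recursion on i, and that recursion is
integration by parts. The coefficient u is quantified inside because the step replaces it by its
derivative. -/
theorem actNF_nfInt_loc_none (i : ℕ) (f : F) : ∀ u : F,
    actNF K F (nfInt K F (nfLoc F none i u)) f = ii K (u * (dd K)^[i] f) := by
  induction i with
  | zero =>
    intro u
    rw [nfInt_loc_zero, actNF_glo, one_mul]; rfl
  | succ i ih =>
    intro u
    -- `ii_mul_dd` supplies the three terms of the recursion, including the boundary term at 0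
    -- carried by e_0 ∂^i.
    rw [nfInt_loc_succ, map_sub, map_sub, LinearMap.sub_apply, LinearMap.sub_apply, ih, actNF_loc,
      actNF_loc, Function.iterate_succ_apply', ii_mul_dd]
    rfl

/-- The action of normal forms is equivariant under the generators. On basis terms this reduces to
the Leibniz rule for ∂, the Rota-Baxter identity and integration by parts for ∫, multiplicativity
for e_b, and the fact that evaluated functions are constants. -/
theorem actNF_nfGen (g : OpGen K F) (n : OpNF K F) (f : F) :
    actNF K F (nfGen K F g n) f = actGen K F g (actNF K F n f) := by
  suffices h : (LinearMap.applyₗ f ∘ₗ actNF K F) ∘ₗ nfGen K F g =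
      actGen K F g ∘ₗ LinearMap.applyₗ f ∘ₗ actNF K F from LinearMap.congr_fun h n
  refine nf_hom_ext K F (fun o i u => ?_) (fun o u v => ?_) <;>
    simp only [LinearMap.comp_apply, LinearMap.applyₗ_apply_apply] <;>
    cases g with
  | fn h => first
    | rw [nfGen, actGen, nfFn_loc, actNF_loc, actNF_loc, LinearMap.mulLeft_apply, mul_assoc]
    | rw [nfGen, actGen, nfFn_glo, actNF_glo, actNF_glo, LinearMap.mulLeft_apply, mul_assoc]
  | der =>
    rw [nfGen, actGen]
    first
    | cases o with
      | none =>
        rw [nfDer_loc_none, map_add, LinearMap.add_apply, actNF_loc, actNF_loc, actNF_loc,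
          Function.iterate_succ_apply', dd_mul]
        exact add_comm _ _
      | some a =>
        rw [nfDer_loc_some, actNF_loc, actNF_loc, dd_mul, dd_evalOp_some, mul_zero, zero_add]
    | cases o with
      | none =>
        rw [nfDer_glo_none, map_add, LinearMap.add_apply, actNF_loc, actNF_glo, actNF_glo, dd_mul]
        change _ + u * v * f = u * dd K (ii K (v * f)) + _
        rw [dd_ii, mul_assoc, add_comm]
      | some a =>
        rw [nfDer_glo_some, actNF_glo, actNF_glo, dd_mul, dd_evalOp_some, mul_zero, zero_add]
  | int =>
    rw [nfGen, actGen]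
    first
    | cases o with
      | none => rw [actNF_nfInt_loc_none, actNF_loc]; rfl
      | some a => rw [nfInt_loc_some, actNF_loc, actNF_loc, ii_mul_evalOp_some]
    | cases o with
      | none =>
        rw [nfInt_glo_none, map_sub, map_sub, LinearMap.sub_apply, actNF_glo, actNF_glo, actNF_glo]
        change ii K u * ii K (v * f) - 1 * ii K (ii K u * v * f) = ii K (u * ii K (v * f))
        rw [ii_mul_ii, one_mul, mul_assoc, add_sub_cancel_left]
      | some a => rw [nfInt_glo_some, actNF_glo, actNF_glo, ii_mul_evalOp_some]
  | ev b =>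
    rw [nfGen, actGen, AlgHom.toLinearMap_apply]
    first
    | cases o with
      | none => rw [nfEv_loc_none, actNF_loc, actNF_loc, map_mul]; rfl
      | some a => rw [nfEv_loc_some, actNF_loc, actNF_loc, map_mul, cst_evalOp_some]
    | cases o with
      | none =>
        rw [nfEv_glo_none, actNF_glo, map_mul]
        -- For b = 0 the normal form is 0 because e_0 ∫ = 0; the action agrees since ∫ takes values
        -- vanishing at 0.
        split_ifs with hb
        · subst hb
          change (actNF K F 0) f = _ * cst K (0 : K) (ii K (v * f))
          rw [cst_zero_ii, map_zero, mul_zero, LinearMap.zero_apply]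
        · rw [actNF_glo]; rfl
      | some a => rw [nfEv_glo_some, actNF_glo, actNF_glo, map_mul (cst K b), cst_evalOp_some]

/-- Equivariance passes from the generators to all operators by lifting to the free algebra. The
normal form n stays general because a product acts on it in two stages. -/
theorem actNF_nfRep (G : OpRing K F) : ∀ (n : OpNF K F) (f : F),
    actNF K F (nfRep K F G n) f = act K F G (actNF K F n f) := by
  obtain ⟨x, rfl⟩ := RingQuot.mkAlgHom_surjective K (OpRel K F) G
  have hn : nfRep K F (RingQuot.mkAlgHom K (OpRel K F) x) = FreeAlgebra.lift K (nfGen K F) x :=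
    RingQuot.liftAlgHom_mkAlgHom_apply _ _ _ _
  have ha : act K F (RingQuot.mkAlgHom K (OpRel K F) x) = FreeAlgebra.lift K (actGen K F) x :=
    RingQuot.liftAlgHom_mkAlgHom_apply _ _ _ _
  rw [hn, ha]
  clear hn ha
  induction x using FreeAlgebra.induction with
  | grade0 r => intro n f; simp [Module.algebraMap_end_apply]
  | grade1 g => intro n f; simp only [FreeAlgebra.lift_ι_apply, actNF_nfGen]
  | mul x y hx hy => intro n f; simp only [map_mul, Module.End.mul_apply, hx, hy]
  | add x y hx hy => intro n f; simp only [map_add, LinearMap.add_apply, hx, hy]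

/-- The action of an operator is given by its normal form. -/
theorem actNF_nf (G : OpRing K F) (f : F) : actNF K F (nf K F G) f = act K F G f := by
  -- The starting vector 1 ∂^0 is the normal form of the identity and acts as such.
  change actNF K F (nfRep K F G (nfLoc F none 0 1)) f = _
  rw [actNF_nfRep, actNF_loc, one_mul]
  rfl

/-! ## Evaluated integrals -/

/-- The convention H(0) = 0 puts a = c on the side where the value is 1. This decides how Diracs at
the endpoints of [α, β] are counted. -/
theorem heavBar_sub (a c : K) :
    heavBar K (a - c) = if a ≤ c then 1 else 0 := by
  by_cases h : a ≤ c
  · simp [heavBar, heav, h, not_lt.2 h]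
  · simp [heavBar, heav, h, not_le.1 h]

variable (K) in
/-- The functional `f ↦ e_c(∫ f δ_a^(i))` is `f ↦ (-1)^i f^(i)(a) (1 - H(a - c) - (1 - H(a)))`. -/
theorem distEvl_distInt_dirac (c a : K) (i : ℕ) : ∀ f : F,
    distEvl K F c (distInt K F (Dist.mk (Finsupp.single (.heav a (i + 1)) f))) =
      (-1 : K) ^ i * evlAt K a ((dd K)^[i] f) * (heavBar K (a - c) - heavBar K a) := by
  have hmk : ∀ ω : AffDiff K F, distEvl K F c (distInt K F (Dist.mk ω)) =
      affEvl K F c (affInt K F ω) := fun ω => rfl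
  induction i with
  | zero =>
    intro f
    rw [hmk, affInt_single, affIntGen, affIntHeav]
    simp only [LinearMap.comp_apply, LinearMap.sub_apply, LinearMap.smul_apply, map_sub, map_smul,
      Finsupp.lsingle_apply, affEvl_single, affEvlGen, AlgHom.toLinearMap_apply, evlAt_cst,
      smul_eq_mul, Function.iterate_zero, id_eq, pow_zero, one_mul]
    ring
  | succ i ih =>
    intro f
    have h : affInt K F (Finsupp.single (.heav a (i + 1 + 1)) f) =
        Finsupp.single (.heav a (i + 1)) f - affInt K F (Finsupp.single (.heav a (i + 1)) (dd K f)) := by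
      rw [affInt_single, affInt_single]; rfl
    -- The boundary term of the integration by parts is again a Dirac, so evaluation kills it; only
    -- a sign and a derivative survive each step.
    have h0 : affEvl K F c (Finsupp.single (.heav a (i + 1)) f) = 0 := affEvl_single K F c _ f
    rw [hmk, h, map_sub, h0, ← hmk, ih, Function.iterate_succ_apply, pow_succ]
    ring

variable (K) in
/-- The functional `f ↦ e_c(∫ f H_a)`. -/
theorem distEvl_distInt_heav (c a : K) (f : F) :
    distEvl K F c (distInt K F (Dist.mk (Finsupp.single (.heav a 0) f))) =
      heavBar K (a - c) * (evlAt K c (ii K f) - evlAt K a (ii K f)) +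
        heavBar K a * evlAt K a (ii K f) := by
  change affEvl K F c (affInt K F (Finsupp.single (.heav a 0) f)) = _
  rw [affInt_single, affIntGen, affIntHeav]
  simp only [LinearMap.comp_apply, LinearMap.sub_apply, LinearMap.add_apply, LinearMap.smul_apply,
    map_add, map_sub, map_smul, Finsupp.lsingle_apply, affEvl_single, affEvlGen,
    AlgHom.toLinearMap_apply, evlAt_cst, smul_eq_mul, LinearMap.id_apply]
  ring

/-- The indefinite integral cancels between the two shifted integrals, leaving an element in the
variable x alone. -/
theorem biDefInt_apply (α β : K) (g : DistBi K F) :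
    biDefInt K F α β g = distX K F (biEvl K F β (biInt K F g) - biEvl K F α (biInt K F g)) := by
  simp only [biDefInt, biIntFrom, LinearMap.sub_apply, LinearMap.comp_apply, LinearMap.id_apply,
    map_sub]
  abel

theorem biEvl_biInt_tensR (c : K) (p : Pcw K F) (ω : Dist K F) :
    biEvl K F c (biInt K F (biT K F (tensR K F (p ⊗ₜ[K] ω)))) =
      pcwToDist K F (distEvl K F c (distInt K F ω) • p) := by
  rw [biInt, DistBi.lift_biT, LinearMap.comp_apply, biEvl, DistBi.lift_biT, tensInt,
    TensDist.lift_tensR, LinearMap.comp_apply, LinearMap.lTensor_tmul, tensEvl,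
    TensDist.lift_tensR]
  simp

theorem biEvl_biD_succ (c : K) (n : ℕ) (p : PcwBi K F) :
    biEvl K F c (biD K F (n + 1) p) = 0 := by
  rw [biEvl, DistBi.lift_biD]; rfl

theorem biEvl_biD_zero (c : K) (p : Pcw K F) (f : F) :
    biEvl K F c (biD K F 0 (p ⊗ₜ[K] pC F f)) =
      pcwToDist K F (evlAt K c f • (p * pH F c)) := by
  rw [biEvl, DistBi.lift_biD, diagEvl_tmul, map_smul]
  congr 1
  exact pcwLift_single K F _ _ f

theorem biEvl_tensP_one (c : K) (p : Pcw K F) :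
    biEvl K F c (biT K F (tensP K F (p ⊗ₜ[K] 1))) = pcwToDist K F p := by
  have h1 : pcwEvl K F c (1 : Pcw K F) = 1 :=
    (pcwLift_single K F _ JoinIdx.one (1 : F)).trans (map_one (evlAt K c))
  rw [biEvl, DistBi.lift_biT, tensEvl_tensP, h1, one_smul]


/-! ### Products in the piecewise extension and integrals of the diagonal kernels -/

theorem smul_eq_pC_mul (f : F) (p : Pcw K F) : f • p = pC F f * p := by
  conv_lhs => rw [← one_mul p, ← smul_mul_assoc]
  congr 1
  change f • MonoidAlgebra.single (1 : JoinIdx K) (1 : F) = _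
  rw [MonoidAlgebra.smul_single, smul_eq_mul, mul_one]
  rfl

/-- Together with `smul_eq_pC_mul`, this turns scalars from K and F into ring elements, so that the
later identities become commutative ring identities. -/
theorem evlAt_smul_eq (c : K) (f : F) (p : Pcw K F) :
    evlAt K c f • p = pC F (cst K c f) * p := by
  rw [← smul_eq_pC_mul, cst_apply, algebraMap_smul]

theorem smul_one_eq_pC (f : F) : f • (1 : Pcw K F) = pC F f := by
  rw [smul_eq_pC_mul, mul_one]

theorem pC_mul (f g : F) : pC F (f * g) = (pC F f * pC F g : Pcw K F) := by
  rw [pC, MonoidAlgebra.lsingle_apply, MonoidAlgebra.lsingle_apply, MonoidAlgebra.lsingle_apply,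
    MonoidAlgebra.single_mul_single]
  rfl

theorem pC_one : pC F (1 : F) = (1 : Pcw K F) := rfl

/-- Setting ξ = c turns H(x-ξ) into H_c(x). The summand with H_0 does not involve c and therefore
disappears from definite integrals. -/
theorem biEvl_diagIntBase_zero (c : K) (f : F) (p : Pcw K F) :
    biEvl K F c (diagIntBase K F 0 f p) =
      pcwToDist K F ((pC F (cst K c (ii K f)) - pC F (ii K f)) * p * pH F c
        + pC F (ii K f) * p * pH F 0) := by
  have h1 : biEvl K F c (biD K F 0 ((ii K f • p) ⊗ₜ[K] 1)) =
      pcwToDist K F (pC F (ii K f) * p * pH F c) := by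
    rw [← pC_one, biEvl_biD_zero, map_one, one_smul, smul_eq_pC_mul]
  change biEvl K F c (biD K F 0 (p ⊗ₜ[K] pC F (ii K f) - (ii K f • p) ⊗ₜ[K] 1)
        + biT K F (tensP K F ((ii K f • (p * pH F 0)) ⊗ₜ[K] 1))) = _
  rw [map_add, biEvl_tensP_one, map_sub, map_sub, biEvl_biD_zero, h1, ← map_sub, ← map_add,
    evlAt_smul_eq, smul_eq_pC_mul]
  congr 1
  ring

/-- With g the n-th derivative of f, the value simplifies to (g - g(0)) p H_0 - g p H_c, and only
the last term depends on c. No alternating sign appears: differentiating H^(n)(x-ξ) in ξ already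
produces a minus sign, which cancels the one from integration by parts. -/
theorem biEvl_diagIntBase_succ (c : K) (n : ℕ) (p : Pcw K F) : ∀ f : F,
    biEvl K F c (diagIntBase K F (n + 1) f p) =
      pcwToDist K F ((pC F ((dd K)^[n] f) - pC F (cst K (0 : K) ((dd K)^[n] f))) * p * pH F 0
        - (pC F ((dd K)^[n] f) - pC F (cst K (0 : K) ((dd K)^[n] f))) * p * pH F c
        - pC F (cst K (0 : K) ((dd K)^[n] f)) * p * pH F c) := by
  have h : ∀ (m : ℕ) (f : F), biEvl K F c (diagIntBase K F (m + 1) f p) =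
      biEvl K F c (diagIntBase K F m (dd K f) p) - biEvl K F c (biD K F m (p ⊗ₜ[K] pC F f)) :=
    fun m f => map_sub (biEvl K F c) _ _
  induction n with
  | zero =>
    intro f
    -- The values at 0 enter through ∫ f' = f - f(0).
    rw [h, biEvl_diagIntBase_zero, biEvl_biD_zero, ← map_sub, evlAt_smul_eq, ii_dd, map_sub (cst K c),
      cst_cst, map_sub (pC F), map_sub (pC F), Function.iterate_zero, id_eq]
    congr 1
    ring
  | succ n ih =>
    intro f
    -- From here on the boundary term is a diagonal Dirac, which evaluates to 0.
    rw [h, biEvl_biD_succ, sub_zero, ih, Function.iterate_succ_apply]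

/-! ## Integrals over an interval -/

theorem mem_offInterval {α β : K} {r : Pcw K F} (a b : Pcw K F)
    (h : r = a * (1 - pH F α) + b * pH F β) : r ∈ offInterval F α β :=
  Ideal.mem_span_pair.2 ⟨a, b, h.symm⟩

/-- Reduces an integral representation to evaluating the antiderivative at the two endpoints,
provided both values are piecewise functions of x. -/
theorem eqIntegral_of_biEvl {α β : K} {g : DistBi K F} {f u : F} {p q : Pcw K F}
    (hp : biEvl K F α (biInt K F (biMul K F 1 f g)) = pcwToDist K F p)
    (hq : biEvl K F β (biInt K F (biMul K F 1 f g)) = pcwToDist K F q)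
    (h : EqOnInterval α β (pC F u) (q - p)) : EqIntegral α β g f u :=
  ⟨q - p, by rw [biDefInt_apply, hp, hq, map_sub], h⟩

/-! ### Linearity of the integral representation -/

theorem EqIntegral.zero (α β : K) (f : F) : EqIntegral α β (0 : DistBi K F) f 0 :=
  ⟨0, by simp only [map_zero], by rw [EqOnInterval, map_zero, sub_zero]; exact zero_mem _⟩

theorem EqIntegral.add {α β : K} {g g' : DistBi K F} {f u u' : F} (h : EqIntegral α β g f u)
    (h' : EqIntegral α β g' f u') : EqIntegral α β (g + g') f (u + u') := by
  obtain ⟨p, hp, hu⟩ := h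
  obtain ⟨q, hq, hu'⟩ := h'
  refine ⟨p + q, by simp only [map_add, hp, hq], ?_⟩
  rw [EqOnInterval, map_add, add_sub_add_comm]
  exact add_mem hu hu'

theorem EqIntegral.smul {α β : K} {g : DistBi K F} {f u : F} (c : K) (h : EqIntegral α β g f u) :
    EqIntegral α β (c • g) f (c • u) := by
  obtain ⟨p, hp, hu⟩ := h
  refine ⟨c • p, by simp only [map_smul, hp], ?_⟩
  rw [EqOnInterval, map_smul, ← smul_sub]
  exact Submodule.smul_of_tower_mem _ c hu

theorem EqIntegral.sub {α β : K} {g g' : DistBi K F} {f u u' : F} (h : EqIntegral α β g f u)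
    (h' : EqIntegral α β g' f u') : EqIntegral α β (g - g') f (u - u') := by
  rw [sub_eq_add_neg, sub_eq_add_neg, ← neg_one_smul K g', ← neg_one_smul K u']
  exact h.add (h'.smul (-1))

theorem EqIntegral.sum {ι : Type*} {α β : K} {f : F} (s : Finset ι) {g : ι → DistBi K F}
    {u : ι → F} (h : ∀ i ∈ s, EqIntegral α β (g i) f (u i)) :
    EqIntegral α β (∑ i ∈ s, g i) f (∑ i ∈ s, u i) := by
  classical
  induction s using Finset.induction_on with
  | empty => exact EqIntegral.zero α β f
  | insert i s hi ih =>
    rw [Finset.sum_insert hi, Finset.sum_insert hi]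
    exact (h i (Finset.mem_insert_self i s)).add
      (ih fun j hj => h j (Finset.mem_insert_of_mem hj))

/-! ### Integrals of the individual kernels -/

theorem biMul_biMul_biD (f u v : F) (n : ℕ) :
    biMul K F 1 f (biMul K F u v (biD K F n 1)) = biD K F n (pC F u ⊗ₜ[K] pC F (v * f)) := by
  rw [Algebra.TensorProduct.one_def, biMul_biD, biMul_biD, one_smul, smul_smul, smul_one_eq_pC,
    smul_one_eq_pC, mul_comm]

theorem biMul_biMul_distXi (f u v : F) (s : DistIdx K) :
    biMul K F 1 f (biMul K F u v (distXi K F (Dist.mk (Finsupp.single s 1)))) =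
      biT K F (tensR K F (pC F u ⊗ₜ[K] Dist.mk (Finsupp.single s (v * f)))) := by
  have h : (v * f) • (Dist.mk (Finsupp.single s 1) : Dist K F) =
      Dist.mk (Finsupp.single s (v * f)) := by
    rw [← mul_one (v * f), ← smul_eq_mul, ← Finsupp.smul_single, smul_eq_mul, mul_one]; rfl
  change biMul K F 1 f (biMul K F u v (biT K F (tensR K F (1 ⊗ₜ[K] _)))) = _
  rw [biMul_tensR, biMul_tensR, one_smul, smul_smul, smul_one_eq_pC, mul_comm f, h]

/-- The factor u(x) is a constant for the ξ-integral, and what remains is a scalar. Both sides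
therefore agree exactly, not just modulo the ideal of the interval. -/
theorem eqIntegral_distXi (α β : K) (f u v : F) (s : DistIdx K) :
    EqIntegral α β (biMul K F u v (distXi K F (Dist.mk (Finsupp.single s 1)))) f
      ((distEvl K F β (distInt K F (Dist.mk (Finsupp.single s (v * f)))) -
        distEvl K F α (distInt K F (Dist.mk (Finsupp.single s (v * f))))) • u) := by
  refine eqIntegral_of_biEvl
    (by rw [biMul_biMul_distXi, biEvl_biInt_tensR]) (by rw [biMul_biMul_distXi, biEvl_biInt_tensR]) ?_
  rw [EqOnInterval, map_smul, ← sub_smul, sub_self]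
  exact zero_mem _

theorem biInt_biD (n : ℕ) (p : Pcw K F) (f : F) :
    biInt K F (biD K F n (p ⊗ₜ[K] pC F f)) = diagIntBase K F n f p := by
  rw [biInt, DistBi.lift_biD]
  exact diagInt_tmul_single K F n p JoinIdx.one f

theorem eqIntegral_biD_zero (α β : K) (f u v : F) :
    EqIntegral α β (biMul K F u v (biD K F 0 1)) f
      (u * (ii K (v * f) - cst K α (ii K (v * f)))) := by
  refine eqIntegral_of_biEvl (by rw [biMul_biMul_biD, biInt_biD, biEvl_diagIntBase_zero])
    (by rw [biMul_biMul_biD, biInt_biD, biEvl_diagIntBase_zero])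
    -- With Φ = ∫ v f, the integral is u (Φ - Φ(α)) H_α - u (Φ - Φ(β)) H_β. Subtracting it from u (Φ
    -- - Φ(α)) leaves these two coefficients.
    (mem_offInterval (pC F u * (pC F (ii K (v * f)) - pC F (cst K α (ii K (v * f)))))
      (pC F u * (pC F (ii K (v * f)) - pC F (cst K β (ii K (v * f))))) ?_)
  rw [pC_mul, map_sub]
  ring

theorem eqIntegral_biD_succ (α β : K) (f u v : F) (i : ℕ) :
    EqIntegral α β (biMul K F u v (biD K F (i + 1) 1)) f (u * (dd K)^[i] (v * f)) := by
  refine eqIntegral_of_biEvl (by rw [biMul_biMul_biD, biInt_biD, biEvl_diagIntBase_succ])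
    (by rw [biMul_biMul_biD, biInt_biD, biEvl_diagIntBase_succ])
    -- The integral is u g (H_α - H_β) with g the i-th derivative of v f, so u g minus it is u g (1
    -- - H_α) + u g H_β.
    (mem_offInterval (pC F u * pC F ((dd K)^[i] (v * f)))
      (pC F u * pC F ((dd K)^[i] (v * f))) ?_)
  rw [pC_mul]
  ring

/-! ## Extraction of normal forms -/

theorem extractNF_loc (o : Option K) (i : ℕ) (u : F) :
    extractNF K F (nfLoc F o i u) = biMul K F u 1 (kerLoc F o i) := by
  rw [extractNF, nfLift_loc]; rfl

theorem extractNF_glo (o : Option K) (u v : F) :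
    extractNF K F (nfGlo F o (u ⊗ₜ[K] v)) = biMul K F u v (kerGlo F o) := by
  rw [extractNF, nfLift_glo]; rfl

theorem eqIntegral_heav_zero {α β : K} (hα : α ≤ 0) (hβ : 0 ≤ β) (f u v : F) :
    EqIntegral α β (biMul K F u v (distXi K F (dH F 0 0))) f (cst K β (ii K (v * f)) * u) := by
  have h := eqIntegral_distXi α β f u v (.heav 0 0)
  -- For α < 0 the indicator vanishes; for α = 0 the antiderivative does.
  have h0 : heavBar K (0 - α) * evlAt K α (ii K (v * f)) = 0 := by
    rw [heavBar_sub]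
    split_ifs with h'
    · rw [le_antisymm hα h', evlAt_zero_ii, mul_zero]
    · rw [zero_mul]
  rw [distEvl_distInt_heav, distEvl_distInt_heav, evlAt_zero_ii, sub_zero, sub_zero, mul_zero,
    h0, heavBar_sub, if_pos hβ, one_mul, add_zero, add_zero, sub_zero, ← cst_mul_eq_smul] at h
  exact h

theorem eqIntegral_heav {a α β : K} (hα : α ≤ a) (hβ : a ≤ β) (f u v : F) :
    EqIntegral α β (biMul K F u v (distXi K F (dH F a 0))) f
      ((cst K β (ii K (v * f)) - cst K a (ii K (v * f))) * u) := by
  have h := eqIntegral_distXi α β f u v (.heav a 0)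
  -- The case a = α is allowed because the difference of the two values then vanishes, even though
  -- the indicator is 1.
  have h0 : heavBar K (a - α) * (evlAt K α (ii K (v * f)) - evlAt K a (ii K (v * f))) = 0 := by
    rw [heavBar_sub]
    split_ifs with h'
    · rw [le_antisymm hα h', sub_self, mul_zero]
    · rw [zero_mul]
  rw [distEvl_distInt_heav, distEvl_distInt_heav, h0, heavBar_sub, if_pos hβ, one_mul,
    zero_add, add_sub_cancel_right, sub_smul, ← cst_mul_eq_smul, ← cst_mul_eq_smul, ← sub_mul] at h
  exact h

theorem eqIntegral_biOne (α β : K) (f u v : F) :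
    EqIntegral α β (biMul K F u v (biOne K F)) f
      ((cst K β (ii K (v * f)) - cst K α (ii K (v * f))) * u) := by
  have h := eqIntegral_distXi α β f u v .one
  have h1 : biOne K F = distXi K F (Dist.mk (Finsupp.single .one 1)) := by
    rw [biOne, tensP_eq, Algebra.TensorProduct.one_def, LinearMap.lTensor_tmul]
    change _ = biT K F (tensR K F (1 ⊗ₜ[K] _))
    congr 3
    exact pcwToDist_single K F JoinIdx.one 1
  have h2 : ∀ c : K, distEvl K F c (distInt K F (Dist.mk (Finsupp.single .one (v * f)))) =
      evlAt K c (ii K (v * f)) := fun c => by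
    change affEvl K F c (affInt K F _) = _
    rw [affInt_single]
    exact affEvl_single K F c .one _
  rw [h2, h2, sub_smul, ← cst_mul_eq_smul, ← cst_mul_eq_smul, ← sub_mul, ← h1] at h
  exact h

/-- The values of Φ = ∫ v f at the endpoints telescope: (Φ - Φ(α)) + Φ(β) - (Φ(β) - Φ(α)) = Φ for ∫,
and Φ(β) - (Φ(β) - Φ(a)) = Φ(a) for e_a ∫. -/
theorem eqIntegral_extractNF_glo {α β : K} (hα : α ≤ 0) (hβ : 0 ≤ β) {o : Option K}
    (ho : ∀ a ∈ o, α ≤ a ∧ a ≤ β) (f : F) (t : F ⊗[K] F) :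
    EqIntegral α β (extractNF K F (nfGlo F o t)) f (actNF K F (nfGlo F o t) f) := by
  induction t using TensorProduct.induction_on with
  | zero => simp only [map_zero]; exact EqIntegral.zero α β f
  | add x y hx hy => simp only [map_add]; exact hx.add hy
  | tmul u v =>
    rw [extractNF_glo, actNF_glo]
    cases o with
    | none =>
      rw [kerGlo, map_sub, map_add]
      convert ((eqIntegral_biD_zero α β f u v).add (eqIntegral_heav_zero hα hβ f u v)).sub
        (eqIntegral_biOne α β f u v) using 1
      change u * ii K (v * f) = _
      ring
    | some a =>
      rw [kerGlo, map_sub]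
      convert (eqIntegral_heav_zero hα hβ f u v).sub
        (eqIntegral_heav (ho a rfl).1 (ho a rfl).2 f u v) using 1
      change u * cst K a (ii K (v * f)) = _
      ring

theorem eqIntegral_extractNF_loc {α β : K} {o : Option K} (ho : ∀ a ∈ o, α < a ∧ a ≤ β)
    (i : ℕ) (f u : F) :
    EqIntegral α β (extractNF K F (nfLoc F o i u)) f (actNF K F (nfLoc F o i u) f) := by
  rw [extractNF_loc, actNF_loc]
  cases o with
  | none =>
    have h := eqIntegral_biD_succ α β f u 1 i
    rw [one_mul] at h
    exact h
  | some a =>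
    have h := (eqIntegral_distXi α β f u 1 (.heav a (i + 1))).smul ((-1) ^ i)
    -- The indicator of a ≤ c is 1 at c = β and, by the strict inequality, 0 at c = α; the offset 1
    -- - H(a) cancels. The sign of the extraction squares away that of the iterated integration by
    -- parts.
    rw [distEvl_distInt_dirac, distEvl_distInt_dirac, heavBar_sub, heavBar_sub,
      if_pos (ho a rfl).2, if_neg (ho a rfl).1.not_ge, ← mul_sub, sub_sub_sub_cancel_right, sub_zero,
      mul_one, one_mul, smul_smul, ← mul_assoc, ← mul_pow, neg_one_mul, neg_neg, one_pow, one_mul,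
      ← cst_mul_eq_smul, mul_comm, ← map_smul] at h
    exact h

/-- The extraction of an integro-differential operator represents the operator as an integral. -/
theorem eqIntegral_extract {G : OpRing K F} {α β : K} (hα : α ≤ 0) (hβ : 0 ≤ β)
    (hpts : ∀ a ∈ evalPts G, α ≤ a ∧ a ≤ β) (hloc : ∀ a ∈ localPts G, α < a) (f : F) :
    EqIntegral α β (extract K F G) f (act K F G f) := by
  -- Summing over the supports alone ensures that every index in the sum really occurs in G, so the
  -- hypotheses on evaluation points apply termwise.
  have hn : nf K F G = (∑ p ∈ (nf K F G).1.support, nfLoc F p.1 p.2 ((nf K F G).1 p)) +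
      ∑ o ∈ (nf K F G).2.support, nfGlo F o ((nf K F G).2 o) := by
    have h1 : (∑ p ∈ (nf K F G).1.support, nfLoc F p.1 p.2 ((nf K F G).1 p)) =
        LinearMap.inl K _ _ (nf K F G).1 := by
      conv_rhs => rw [← Finsupp.sum_single (nf K F G).1, Finsupp.sum, map_sum]
      rfl
    have h2 : (∑ o ∈ (nf K F G).2.support, nfGlo F o ((nf K F G).2 o)) =
        LinearMap.inr K _ _ (nf K F G).2 := by
      conv_rhs => rw [← Finsupp.sum_single (nf K F G).2, Finsupp.sum, map_sum]
      rfl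
    rw [h1, h2]
    simp
  rw [← actNF_nf]
  change EqIntegral α β (extractNF K F (nf K F G)) f _
  rw [hn]
  simp only [map_add, map_sum, LinearMap.add_apply, LinearMap.sum_apply]
  refine (EqIntegral.sum _ fun p hp => eqIntegral_extractNF_loc ?_ _ _ _).add
    (EqIntegral.sum _ fun o ho => eqIntegral_extractNF_glo hα hβ ?_ _ _)
  · obtain ⟨o, i⟩ := p
    rintro a rfl
    have ha : a ∈ localPts G := ⟨i, Finsupp.mem_support_iff.1 hp⟩
    exact ⟨hloc a ha, (hpts a (Or.inl ha)).2⟩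
  · rintro a rfl
    exact hpts a (Or.inr (Finsupp.mem_support_iff.1 ho))

/-! ### Existence and uniqueness of solutions of boundary problems -/

namespace BoundaryProblem

theorem mem_admissible_iff (P : BoundaryProblem K F) (u : F) :
    u ∈ P.admissible ↔ ∀ i, P.cond i u = 0 := by
  rw [admissible, space, Submodule.mem_dualCoannihilator]
  refine ⟨fun h i => h _ (Submodule.subset_span ⟨i, rfl⟩), fun h φ hφ => ?_⟩
  induction hφ using Submodule.span_induction with
  | mem φ hφ => obtain ⟨i, rfl⟩ := hφ; exact h i
  | zero => rfl
  | add φ ψ _ _ h1 h2 => rw [LinearMap.add_apply, h1, h2, add_zero]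
  | smul c φ _ h1 => rw [LinearMap.smul_apply, h1, smul_zero]

theorem IsGreenOperator.isSolution {P : BoundaryProblem K F} {G : OpRing K F}
    (h : P.IsGreenOperator G) (f : F) : P.IsSolution f (act K F G f) :=
  ⟨h.1 f, (P.mem_admissible_iff _).1 (h.2 ▸ LinearMap.mem_range_self _ f)⟩

/-- The difference of two solutions lies in the kernel of T and is admissible, and the direct sum
makes this intersection trivial. -/
theorem IsRegular.isSolution_unique {P : BoundaryProblem K F} (hP : P.IsRegular) {f u u' : F}
    (h : P.IsSolution f u) (h' : P.IsSolution f u') : u = u' := by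
  refine sub_eq_zero.1 ((Submodule.disjoint_def.1 hP.disjoint) (u - u') ?_ ?_)
  · rw [LinearMap.mem_ker, map_sub, h.1, h'.1, sub_self]
  · exact sub_mem ((P.mem_admissible_iff u).2 h.2) ((P.mem_admissible_iff u').2 h'.2)

end BoundaryProblem

end IntDiffDirac

end

theorem mainTheorem8 {K F : Type*} [Field K] [LinearOrder K] [IsStrictOrderedRing K]
    [CommRing F] [Algebra K F] [IntDiffDirac.OrdinaryShiftedIDAlgebra K F]
    (G : IntDiffDirac.OpRing K F) (α β : K) (hαβ : α < β) (hα : α ≤ 0) (hβ : 0 ≤ β)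
    (hpts : ∀ a ∈ IntDiffDirac.evalPts G, α ≤ a ∧ a ≤ β)
    (hloc : ∀ a ∈ IntDiffDirac.localPts G, α < a) :
    (∀ f : F, IntDiffDirac.EqIntegral α β (IntDiffDirac.extract K F G) f
      (IntDiffDirac.act K F G f)) ∧
    (∀ P : IntDiffDirac.BoundaryProblem K F, P.IsRegular → P.IsGreenOperator G →
      P.IsGreenFunction α β (IntDiffDirac.extract K F G)) := by
  have h := IntDiffDirac.eqIntegral_extract hα hβ hpts hloc
  refine ⟨h, fun P hP hG f => ⟨⟨_, hG.isSolution f, fun u hu => ?_⟩, fun u hu => ?_⟩⟩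
  · exact hP.isSolution_unique hu (hG.isSolution f)
  -- By uniqueness the given solution is G f, for which the integral formula is already known.
  · rw [hP.isSolution_unique hu (hG.isSolution f)]
    exact h f
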